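/- **Proposition.** (i) Let $E=\mathbf C/\Lambda$ be an elliptic curve, let $B$ be a compact connected Riemann surface of genus $g\ge 2$, where $g=\dim H^0(B,K_B)$, and let $S\to B$ be a holomorphic principal bundle with structure group $E$ whose total space $S$ (a compact complex surface) has odd first Betti number $b_1(S)$. Then every torsion-free holomorphic affine connection on $S$ is projectively flat. (ii) Every torsion-free holomorphic affine connection on $\mathbf C^2$ which is invariant under translations is projectively flat. Here a torsion-free holomorphic affine connection $\nabla$ on a complex surface is called *projectively flat* if the projective connection it defines is locally isomorphic to the standard one of $P^2(\mathbf C)$, that is, if every point has a neighbourhood $U$ with a holomorphic chart $\varphi:U\to\mathbf C^2$ and a one-form $\alpha$ on $U$ such that $\nabla_XY=\nabla^0_XY+\alpha(X)Y+\alpha(Y)X$ for all holomorphic vector fields $X,Y$ on open subsets of $U$, where $\nabla^0$ is the pull-back by $\varphi$ of the standard flat connection of $\mathbf C^2$. -/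

import Mathlib

open Bundle Set Topology
open scoped Manifold ContDiff

/-! ### Elliptic curves and principal elliptic bundles -/

/-- The elliptic curve `ℂ / (ℤ ω₁ + ℤ ω₂)`. -/
abbrev EllipticCurveOf (L : PeriodPair) : Type := ℂ ⧸ L.lattice.toAddSubgroup

theorem isLocalHomeomorph_ellipticMk (L : PeriodPair) :
    IsLocalHomeomorph (QuotientAddGroup.mk : ℂ → EllipticCurveOf L) := by
  have : DiscreteTopology L.lattice.toAddSubgroup :=
    inferInstanceAs (DiscreteTopology L.lattice)
  exact (AddSubgroup.isAddQuotientCoveringMap_of_comm L.lattice.toAddSubgroup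
    DiscreteTopology.isDiscrete).isCoveringMap.isLocalHomeomorph

/-- The charts of `ℂ / Λ` are the local inverses of the quotient map `ℂ → ℂ / Λ`. -/
noncomputable instance ellipticChartedSpace (L : PeriodPair) :
    ChartedSpace ℂ (EllipticCurveOf L) :=
  (isLocalHomeomorph_ellipticMk L).chartedSpace QuotientAddGroup.mk_surjective

/-- Every chart in the atlas is a local inverse of the quotient map. -/
theorem mk_ellipticChart (L : PeriodPair) {e : OpenPartialHomeomorph (EllipticCurveOf L) ℂ}
    (he : e ∈ atlas ℂ (EllipticCurveOf L)) {z : ℂ} (hz : z ∈ e.target) :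
    e.symm z = (QuotientAddGroup.mk z : EllipticCurveOf L) := by
  obtain ⟨q, rfl⟩ := he
  rw [chartAt_self_eq]
  simp

/-- Coordinate changes are locally translations, so `ℂ / Λ` is a complex manifold. -/
instance ellipticIsManifold (L : PeriodPair) : IsManifold 𝓘(ℂ, ℂ) ω (EllipticCurveOf L) := by
  refine isManifold_of_contDiffOn _ _ _ fun e e' he he' => ?_
  simp only [modelWithCornersSelf_coe, modelWithCornersSelf_coe_symm, Function.comp_id,
    Function.id_comp, Set.preimage_id, Set.range_id, Set.inter_univ]
  intro x hx
  have hopen := (e.symm.trans e').open_source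
  have hmk : ∀ y ∈ (e.symm.trans e').source, (e.symm.trans e') y - y ∈ L.lattice := by
    intro y hy
    have h1 := mk_ellipticChart L he' ((e.symm.trans e').map_source hy).1
    have hy' := hy
    simp only [OpenPartialHomeomorph.trans_source, OpenPartialHomeomorph.symm_source,
      Set.mem_inter_iff, Set.mem_preimage] at hy'
    have h2 := mk_ellipticChart L he hy'.1
    have h3 : e'.symm ((e.symm.trans e') y) = e.symm y := by
      simpa using e'.left_inv hy'.2
    rw [h1, h2] at h3
    have h4 := (QuotientAddGroup.eq.mp h3.symm)
    rwa [neg_add_eq_sub] at h4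
  have hcont : ContinuousAt (fun y => (e.symm.trans e') y - y) x :=
    ((e.symm.trans e').continuousAt hx).sub continuousAt_id
  obtain ⟨N, hN, hNL⟩ : ∃ N ∈ 𝓝 ((e.symm.trans e') x - x), N ∩ (L.lattice : Set ℂ) ⊆
      {(e.symm.trans e') x - x} := by
    have hd : DiscreteTopology (L.lattice : Set ℂ) :=
      inferInstanceAs (DiscreteTopology L.lattice)
    obtain ⟨N, hN, h⟩ := (mem_nhds_induced _ _ _).mp
      ((isOpen_discrete ({⟨_, hmk x hx⟩} : Set (L.lattice : Set ℂ))).mem_nhds rfl)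
    exact ⟨N, hN, fun y hy => congrArg Subtype.val
      (h (show (⟨y, hy.2⟩ : (L.lattice : Set ℂ)) ∈ Subtype.val ⁻¹' N from hy.1))⟩
  have hev : (e.symm.trans e') =ᶠ[𝓝 x] fun y => y + ((e.symm.trans e') x - x) := by
    filter_upwards [hcont hN, hopen.mem_nhds hx] with y hy hys
    have := hNL ⟨hy, hmk y hys⟩
    rw [← Set.mem_singleton_iff.mp this]
    ring
  exact ((contDiffAt_id.add contDiffAt_const).congr_of_eventuallyEq hev).contDiffWithinAt

/-- `p : S → B` is a holomorphic principal bundle with structure group the elliptic curve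
`ℂ / Λ` acting on the complex surface `S`, over the Riemann surface `B`: the action preserves
the fibres of `p`, and around each point of `B` there is a biholomorphic trivialization
`p⁻¹(U) ≃ U × ℂ / Λ` over `U` which is equivariant. -/
structure IsPrincipalEllipticBundle (L : PeriodPair)
    {B : Type*} [TopologicalSpace B] [ChartedSpace ℂ B]
    {S : Type*} [TopologicalSpace S] [ChartedSpace (ℂ × ℂ) S]
    [AddAction (EllipticCurveOf L) S] (p : S → B) : Prop where
  proj_vadd : ∀ (t : EllipticCurveOf L) (s : S), p (t +ᵥ s) = p s
  locally_trivial : ∀ b : B, ∃ e : Trivialization (EllipticCurveOf L) p,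
    b ∈ e.baseSet ∧
    ContMDiffOn 𝓘(ℂ, ℂ × ℂ) (𝓘(ℂ, ℂ).prod 𝓘(ℂ, ℂ)) ω e e.source ∧
    ContMDiffOn (𝓘(ℂ, ℂ).prod 𝓘(ℂ, ℂ)) 𝓘(ℂ, ℂ × ℂ) ω e.toOpenPartialHomeomorph.symm e.target ∧
    ∀ s ∈ e.source, ∀ t : EllipticCurveOf L, e (t +ᵥ s) = (p s, t + (e s).2)

/-! ### Numerical invariants -/

/-- The genus of a compact Riemann surface: the dimension of the space `H⁰(B, K_B)` of
holomorphic one-forms, i.e. of holomorphic sections of the cotangent bundle. -/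
noncomputable def riemannSurfaceGenus (B : Type*) [TopologicalSpace B] [ChartedSpace ℂ B]
    [IsManifold 𝓘(ℂ, ℂ) ω B] : ℕ :=
  Module.finrank ℂ (ContMDiffSection 𝓘(ℂ, ℂ) (ℂ →L[ℂ] ℂ) ω
    (fun x : B => TangentSpace 𝓘(ℂ, ℂ) x →L[ℂ] Bundle.Trivial B ℂ x))

universe u v

/-- The first Betti number: the dimension of the singular homology `H₁(X; ℚ)`. -/
noncomputable def firstBettiNumber (X : Type u) [TopologicalSpace X] : ℕ :=
  Module.finrank ℚ (((AlgebraicTopology.singularHomologyFunctor (ModuleCat.{u} ℚ) 1).obj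
    (ModuleCat.of ℚ (ULift.{u} ℚ))).obj (TopCat.of X))

/-! ### Holomorphic affine connections -/

section Connections

variable {V : Type*} [NormedAddCommGroup V] [NormedSpace ℂ V]
  {M : Type*} [TopologicalSpace M] [ChartedSpace V M]

/-- An affine connection (a covariant derivative on the tangent bundle of a complex manifold;
`D Y x v` is `(∇_v Y)(x)`) is holomorphic if `∇Y` is holomorphic on each open set `U` on which
the vector field `Y` is holomorphic. -/
def IsHolomorphicConnection [IsManifold 𝓘(ℂ, V) ω M]
    (D : CovariantDerivative 𝓘(ℂ, V) V (TangentSpace 𝓘(ℂ, V) : M → Type _)) : Prop :=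
  ∀ U : Set M, IsOpen U → ContMDiffCovariantDerivativeOn V ω D.toFun U

/-- The differential at `x` of a `V`-valued map `f` on `M`, with values in `V`. -/
noncomputable def vderiv (f : M → V) (x : M) : TangentSpace 𝓘(ℂ, V) x →L[ℂ] V :=
  mfderiv 𝓘(ℂ, V) 𝓘(ℂ, V) f x

/-- A torsion-free affine connection `D` is projectively flat if around each point `p` there is a
holomorphic chart `φ` of `M` in which `D` is projectively equivalent to the standard flat
connection of the affine space `V` (which defines the standard projective connection of the
projective space of which `V` is an affine chart), that is,
`dφ(∇_v Y) = v · dφ(Y) + α(v) dφ(Y) + α(Y) dφ(v)` on the domain of `φ` for a one-form `α`.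
The form `α` is determined by `D` and `φ`, and is holomorphic if `D` is. -/
def IsProjectivelyFlat [IsManifold 𝓘(ℂ, V) ω M]
    (D : CovariantDerivative 𝓘(ℂ, V) V (TangentSpace 𝓘(ℂ, V) : M → Type _)) : Prop :=
  ∀ p : M, ∃ φ ∈ IsManifold.maximalAtlas 𝓘(ℂ, V) ω M, p ∈ φ.source ∧
    ∃ α : ∀ x : M, TangentSpace 𝓘(ℂ, V) x →L[ℂ] ℂ,
      ∀ x ∈ φ.source, ∀ Y : (∀ y : M, TangentSpace 𝓘(ℂ, V) y),
        MDifferentiableAt 𝓘(ℂ, V) (𝓘(ℂ, V).prod 𝓘(ℂ, V))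
          (fun y => (⟨y, Y y⟩ : TotalSpace V (TangentSpace 𝓘(ℂ, V) : M → Type _))) x →
        ∀ v : TangentSpace 𝓘(ℂ, V) x,
          vderiv φ x (D Y x v) =
            vderiv (fun y => vderiv φ y (Y y)) x v
              + α x v • vderiv φ x (Y x) + α x (Y x) • vderiv φ x v

/-- An affine connection on the vector space `V` is translation-invariant if it commutes with the
action of the translations on vector fields (tangent spaces of `V` being identified with `V`). -/
def IsTranslationInvariant
    (D : CovariantDerivative 𝓘(ℂ, V) V (TangentSpace 𝓘(ℂ, V) : V → Type _)) : Prop :=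
  ∀ (a : V) (Y : V → V) (x v : V), DifferentiableAt ℂ Y (x + a) →
    (D (fun y => Y (y + a)) x v : V) = D Y (x + a) v

end Connections

/-! Both parts reduce to one local model. Suppose that in coordinates (z, w) the Christoffel symbols
depend on z only, with ∇_∂w ∂w = c ∂w, ∇_∂z ∂w = d ∂z + b ∂w, ∇_∂z ∂z = a ∂z + e ∂w, and c, d
constant. A geodesic that is a graph w(z) satisfies w'' = -k w'² + (a - 2b) w' - e, where k = c -
2d. If θ is a function of w with θ' = kθ + 1, then y = θ(w(z)) satisfies the linear equation y'' =
(a - 2b) y' - k e y - e. Adding a suitable function g(z) makes it homogeneous; with independent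
homogeneous solutions u, f, the geodesics satisfy θ(w) + g = A u + B f, so they are straight lines
in the coordinates (f/u, (θ(w) + g)/u). This is `exists_linearizing_map`; `exists_flat_chart`
carries it to a manifold.

On the plane, a translation-invariant connection has constant symbols in every linear chart. The
quadratic map v ↦ Γ(v, v) has an eigenvector, found from a root of a cubic, and a linear change of
coordinates makes it ∂w (`exists_linearEquiv_eigenvector`).

On a principal bundle, local coordinates are chosen with z from the base and w from the fibre. The
symbols are holomorphic along the compact fibres, hence functions of z
(`christoffel_bundleChart_eq`). Let X be the vertical field generating the action. For a holomorphic
one-form α on B, the function α(dp(∇_X X)) is holomorphic on the compact connected S, hence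
constant. Genus at least two leaves a nonzero α for which the constant is 0, so dp(∇_X X) = 0 off
the zeros of α, and everywhere by continuity. Thus ∇_X X = cX with c constant by compactness. The
trace of ∇X is c + d in these coordinates, so d is constant too by the same argument. -/

/-! ### Holomorphic linear differential equations -/

section LinearODE

variable {E : Type*} [NormedAddCommGroup E] [NormedSpace ℂ E] [CompleteSpace E]

/-- Local existence of holomorphic solutions of linear differential equations `u' = A u + b`. -/
theorem exists_hasDerivAt_linear {A : ℂ → E →L[ℂ] E} {b : ℂ → E} {z₀ : ℂ}
    (hA : ∀ᶠ z in 𝓝 z₀, DifferentiableAt ℂ A z) (hb : ∀ᶠ z in 𝓝 z₀, DifferentiableAt ℂ b z)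
    (u₀ : E) :
    ∃ u : ℂ → E, u z₀ = u₀ ∧ ∀ᶠ z in 𝓝 z₀, HasDerivAt u (A z (u z) + b z) z := by
  set M : ℝ := ‖A z₀‖ + 1 with hM
  have hMpos : 0 < M := by positivity
  have hAc : ∀ᶠ z in 𝓝 z₀, ‖A z‖ < M :=
    hA.self_of_nhds.continuousAt.norm.eventually_lt_const (by linarith)
  have hbc : ∀ᶠ z in 𝓝 z₀, ‖b z‖ < ‖b z₀‖ + 1 :=
    hb.self_of_nhds.continuousAt.norm.eventually_lt_const (by linarith)
  obtain ⟨r₀, hr₀, hball⟩ := Metric.eventually_nhds_iff_ball.1 (((hA.and hb).and hAc).and hbc)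
  -- With M r ≤ 1/2, multiplying by A and integrating from the centre at least halves the sup norm.
  set r : ℝ := min r₀ (1 / (2 * M)) with hr
  have hrpos : 0 < r := lt_min hr₀ (by positivity)
  have hrM : M * r ≤ 1 / 2 := by
    calc M * r ≤ M * (1 / (2 * M)) := by gcongr; exact min_le_right _ _
      _ = 1 / 2 := by field_simp
  set U := Metric.ball z₀ r with hU
  have hUr : ∀ z ∈ U, z ∈ Metric.ball z₀ r₀ := Metric.ball_subset_ball (min_le_left _ _)
  have hz₀ : z₀ ∈ U := Metric.mem_ball_self hrpos
  have hAd : DifferentiableOn ℂ A U := fun z hz =>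
    (hball z (hUr z hz)).1.1.1.differentiableWithinAt
  have hbd : DifferentiableOn ℂ b U := fun z hz =>
    (hball z (hUr z hz)).1.1.2.differentiableWithinAt
  have hprim : ∀ f : ℂ → E, DifferentiableOn ℂ f U → ∃ g : ℂ → E, g z₀ = 0 ∧
      ∀ z ∈ U, HasDerivAt g (f z) z := fun f hf => hf.isExactOn_ball.with_val_at z₀ 0
  -- Made total, with junk value 0, so that one operator `P` picks a primitive vanishing at `z₀` for
  -- every holomorphic `f`.
  have hprim' : ∀ f : ℂ → E, ∃ g : ℂ → E, DifferentiableOn ℂ f U → g z₀ = 0 ∧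
      ∀ z ∈ U, HasDerivAt g (f z) z := fun f => by
    by_cases hf : DifferentiableOn ℂ f U
    · obtain ⟨g, hg⟩ := hprim f hf
      exact ⟨g, fun _ => hg⟩
    · exact ⟨0, fun h => absurd h hf⟩
  choose P hP using hprim'
  have hPd : ∀ f, DifferentiableOn ℂ f U → DifferentiableOn ℂ (P f) U := fun f hf z hz =>
    ((hP f hf).2 z hz).differentiableAt.differentiableWithinAt
  have hPbound : ∀ f, DifferentiableOn ℂ f U → ∀ K, (∀ z ∈ U, ‖f z‖ ≤ K) →
      ∀ z ∈ U, ‖P f z‖ ≤ K * r := by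
    intro f hf K hK z hz
    have h := (convex_ball z₀ r).norm_image_sub_le_of_norm_hasDerivWithin_le
      (fun x hx => ((hP f hf).2 x hx).hasDerivWithinAt) hK hz₀ hz
    rw [(hP f hf).1, sub_zero] at h
    refine h.trans ?_
    have : 0 ≤ K := (norm_nonneg _).trans (hK z₀ hz₀)
    gcongr
    exact (mem_ball_iff_norm.1 hz).le
  -- The increments of Picard iteration: their sum solves the integral equation u = u₀ + ∫ b + ∫ A
  -- u.
  let v : ℕ → ℂ → E := fun n =>
    Nat.rec (fun z => u₀ + P b z) (fun _ w => P fun z => A z (w z)) n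
  have hv0 : v 0 = fun z => u₀ + P b z := rfl
  have hvs : ∀ n, v (n + 1) = P fun z => A z (v n z) := fun n => rfl
  have hvd : ∀ n, DifferentiableOn ℂ (v n) U := by
    intro n
    induction n with
    | zero => exact (hPd b hbd).const_add u₀
    | succ n ih => exact hPd _ (hAd.clm_apply ih)
  set C : ℝ := ‖u₀‖ + (‖b z₀‖ + 1) * r with hC
  have hvb : ∀ n, ∀ z ∈ U, ‖v n z‖ ≤ C * (1 / 2) ^ n := by
    intro n
    induction n with
    | zero =>
      intro z hz
      rw [hv0, pow_zero, mul_one]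
      refine (norm_add_le _ _).trans (add_le_add le_rfl ?_)
      exact hPbound b hbd _ (fun x hx => (hball x (hUr x hx)).2.le) z hz
    | succ n ih =>
      intro z hz
      rw [hvs]
      have h := hPbound _ (hAd.clm_apply (hvd n)) (M * (C * (1 / 2) ^ n)) (fun x hx => by
        refine (ContinuousLinearMap.le_opNorm _ _).trans ?_
        gcongr
        · exact (hball x (hUr x hx)).1.2.le
        · exact ih x hx) z hz
      refine h.trans ?_
      have hC0 : 0 ≤ C * (1 / 2) ^ n := by positivity
      calc M * (C * (1 / 2) ^ n) * r = (M * r) * (C * (1 / 2) ^ n) := by ring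
        _ ≤ 1 / 2 * (C * (1 / 2) ^ n) := by gcongr
        _ = C * (1 / 2) ^ (n + 1) := by ring
  have hsum : Summable fun n : ℕ => C * (1 / 2 : ℝ) ^ n :=
    (summable_geometric_of_lt_one (by norm_num) (by norm_num)).mul_left C
  have hopen : IsOpen U := Metric.isOpen_ball
  have hsv : ∀ z ∈ U, Summable fun n => v n z := fun z hz =>
    Summable.of_norm_bounded hsum fun n => hvb n z hz
  refine ⟨fun z => ∑' n, v n z, ?_, ?_⟩
  · have h : ∀ n, n ≠ 0 → v n z₀ = 0 := by
      intro n hn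
      obtain ⟨m, rfl⟩ := Nat.exists_eq_succ_of_ne_zero hn
      exact (hP _ (hAd.clm_apply (hvd m))).1
    show ∑' n, v n z₀ = u₀
    rw [tsum_eq_single 0 h]
    show u₀ + P b z₀ = u₀
    rw [(hP b hbd).1, add_zero]
  · filter_upwards [hopen.mem_nhds hz₀] with z hz
    have hd := ((Complex.differentiableOn_tsum_of_summable_norm hsum hvd hopen hvb).differentiableAt
      (hopen.mem_nhds hz)).hasDerivAt
    have hs := Complex.hasSum_deriv_of_summable_norm hsum hvd hopen hvb hz
    have h0 : deriv (v 0) z = b z := (((hP b hbd).2 z hz).const_add u₀).deriv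
    have hn : ∀ n, deriv (v (n + 1)) z = A z (v n z) := fun n =>
      ((hP _ (hAd.clm_apply (hvd n))).2 z hz).deriv
    have hs' := (hasSum_nat_add_iff' 1).2 hs
    simp only [Finset.sum_range_one, h0, hn] at hs'
    have h2 := hs'.unique ((A z).hasSum (hsv z hz).hasSum)
    rw [sub_eq_iff_eq_add] at h2
    rwa [h2] at hd

/-- Local existence of holomorphic solutions of linear differential equations of order two. -/
theorem exists_hasDerivAt_linear_two {q s f : ℂ → ℂ} {z₀ : ℂ}
    (hq : ∀ᶠ z in 𝓝 z₀, DifferentiableAt ℂ q z) (hs : ∀ᶠ z in 𝓝 z₀, DifferentiableAt ℂ s z)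
    (hf : ∀ᶠ z in 𝓝 z₀, DifferentiableAt ℂ f z) (u₀ u₁ : ℂ) :
    ∃ u u' : ℂ → ℂ, u z₀ = u₀ ∧ u' z₀ = u₁ ∧ ∀ᶠ z in 𝓝 z₀, HasDerivAt u (u' z) z ∧
      HasDerivAt u' (q z * u' z + s z * u z + f z) z := by
  -- The companion system for the pair (u, u').
  let A : ℂ → ℂ × ℂ →L[ℂ] ℂ × ℂ := fun z =>
    (ContinuousLinearMap.snd ℂ ℂ ℂ).prod
      (q z • ContinuousLinearMap.snd ℂ ℂ ℂ + s z • ContinuousLinearMap.fst ℂ ℂ ℂ)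
  have hAeq : A = fun z => (ContinuousLinearMap.inl ℂ ℂ ℂ).comp (ContinuousLinearMap.snd ℂ ℂ ℂ)
      + (q z • (ContinuousLinearMap.inr ℂ ℂ ℂ).comp (ContinuousLinearMap.snd ℂ ℂ ℂ)
        + s z • (ContinuousLinearMap.inr ℂ ℂ ℂ).comp (ContinuousLinearMap.fst ℂ ℂ ℂ)) := by
    funext z
    ext <;> simp [A]
  have hA : ∀ᶠ z in 𝓝 z₀, DifferentiableAt ℂ A z := by
    filter_upwards [hq, hs] with z h1 h2
    rw [hAeq]
    fun_prop
  have hb : ∀ᶠ z in 𝓝 z₀, DifferentiableAt ℂ (fun z => ((0 : ℂ), f z)) z := by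
    filter_upwards [hf] with z h
    fun_prop
  obtain ⟨w, hw0, hw⟩ := exists_hasDerivAt_linear hA hb (u₀, u₁)
  refine ⟨fun z => (w z).1, fun z => (w z).2, by simp [hw0], by simp [hw0], ?_⟩
  filter_upwards [hw] with z hz
  refine ⟨?_, ?_⟩
  · simpa [A] using (hz.hasFDerivAt.fst).hasDerivAt
  · simpa [A] using (hz.hasFDerivAt.snd).hasDerivAt

end LinearODE

/-! ### Linearization of the geodesics in local coordinates -/

section LocalLinearization

/-- The symmetric bilinear form with components `(a, d, 0)` and `(e, b, c)`, the Christoffel symbols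
of an affine connection on a surface one of whose coordinate lines is a geodesic. -/
noncomputable def christoffelForm (a b c d e : ℂ) (v y : ℂ × ℂ) : ℂ × ℂ :=
  (a * v.1 * y.1 + d * (v.1 * y.2 + v.2 * y.1),
    e * v.1 * y.1 + b * (v.1 * y.2 + v.2 * y.1) + c * v.2 * y.2)

/-- A primitive `θ` of `exp (k w)` which vanishes at `w₀`. -/
theorem exists_exp_primitive (k w₀ : ℂ) :
    ∃ θ θ' : ℂ → ℂ, θ w₀ = 0 ∧ θ' w₀ = 1 ∧ (∀ w, θ' w = k * θ w + 1) ∧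
      (∀ w, HasDerivAt θ (θ' w) w) ∧ ∀ w, HasDerivAt θ' (k * θ' w) w := by
  rcases eq_or_ne k 0 with rfl | hk
  · refine ⟨fun w => w - w₀, fun _ => 1, by simp, rfl, by simp, fun w => ?_, fun w => ?_⟩
    · exact (hasDerivAt_id w).sub_const w₀
    · simpa using hasDerivAt_const w (1 : ℂ)
  · have hE : ∀ w, HasDerivAt (fun w => Complex.exp (k * (w - w₀)))
        (k * Complex.exp (k * (w - w₀))) w := fun w => by
      have := (((hasDerivAt_id w).sub_const w₀).const_mul k).cexp
      simpa [mul_comm] using this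
    refine ⟨fun w => (Complex.exp (k * (w - w₀)) - 1) / k, fun w => Complex.exp (k * (w - w₀)),
      by simp, by simp, fun w => by field_simp; ring, fun w => ?_, hE⟩
    have := ((hE w).sub_const 1).div_const k
    simpa [hk] using this

/-- If the Christoffel symbols `a, b, e` depend on the first coordinate only and `c, d` are
constant, then the geodesics are straight lines in suitable local coordinates `F`. -/
theorem exists_linearizing_map {a b e : ℂ → ℂ} (c d : ℂ) {z₀ : ℂ} (w₀ : ℂ)
    (ha : ∀ᶠ z in 𝓝 z₀, DifferentiableAt ℂ a z) (hb : ∀ᶠ z in 𝓝 z₀, DifferentiableAt ℂ b z)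
    (he : ∀ᶠ z in 𝓝 z₀, DifferentiableAt ℂ e z) :
    ∃ (F : ℂ × ℂ → ℂ × ℂ) (F' : ℂ × ℂ → (ℂ × ℂ →L[ℂ] ℂ × ℂ))
      (α : ℂ × ℂ → (ℂ × ℂ →L[ℂ] ℂ)),
      F' (z₀, w₀) = ContinuousLinearMap.id ℂ (ℂ × ℂ) ∧
      (∀ᶠ x in 𝓝 (z₀, w₀), ContDiffAt ℂ ω F x) ∧
      ∀ᶠ x in 𝓝 (z₀, w₀), HasFDerivAt F (F' x) x ∧
        ∃ F'' : ℂ × ℂ →L[ℂ] (ℂ × ℂ →L[ℂ] ℂ × ℂ), HasFDerivAt F' F'' x ∧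
          ∀ v y, F' x (christoffelForm (a x.1) (b x.1) c d (e x.1) v y) =
            F'' v y + α x v • F' x y + α x y • F' x v := by
  -- The coefficient of -w'² in the equation of the geodesics as graphs over z; θ is chosen to
  -- absorb this term.
  set k : ℂ := c - 2 * d with hk
  have hq : ∀ᶠ z in 𝓝 z₀, DifferentiableAt ℂ (fun z => a z - 2 * b z) z := by
    filter_upwards [ha, hb] with z h1 h2
    fun_prop
  have hs : ∀ᶠ z in 𝓝 z₀, DifferentiableAt ℂ (fun z => -k * e z) z := by
    filter_upwards [he] with z h1
    fun_prop
  have h0 : ∀ᶠ z in 𝓝 z₀, DifferentiableAt ℂ (fun _ => (0 : ℂ)) z :=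
    .of_forall fun _ => differentiableAt_const _
  -- Here `u` and `f` are a fundamental system of the homogeneous equation and `g` cancels the term
  -- -e. The initial values make the differential of `F` the identity at the base point.
  obtain ⟨u, u', hu0, hu0', hu⟩ := exists_hasDerivAt_linear_two hq hs h0 1 0
  obtain ⟨f, f', hf0, hf0', hf⟩ := exists_hasDerivAt_linear_two hq hs h0 0 1
  obtain ⟨g, g', hg0, hg0', hg⟩ := exists_hasDerivAt_linear_two hq hs he 0 0
  obtain ⟨θ, θ', hθ0, hθ0', hθk, hθ, hθ'⟩ := exists_exp_primitive k w₀
  have hune : ∀ᶠ z in 𝓝 z₀, u z ≠ 0 :=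
    hu.self_of_nhds.1.continuousAt.eventually_ne (by simp [hu0])
  have hfst : Filter.Tendsto Prod.fst (𝓝 (z₀, w₀)) (𝓝 z₀) := continuousAt_fst
  let p : ℂ × ℂ → ℂ := fun x => (f' x.1 - f x.1 * u' x.1 * (u x.1)⁻¹) * (u x.1)⁻¹
  let q : ℂ × ℂ → ℂ := fun x => (g' x.1 - (θ x.2 + g x.1) * u' x.1 * (u x.1)⁻¹) * (u x.1)⁻¹
  let s : ℂ × ℂ → ℂ := fun x => θ' x.2 * (u x.1)⁻¹
  let e₁₁ : ℂ × ℂ →L[ℂ] ℂ × ℂ :=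
    (ContinuousLinearMap.inl ℂ ℂ ℂ).comp (ContinuousLinearMap.fst ℂ ℂ ℂ)
  let e₂₁ : ℂ × ℂ →L[ℂ] ℂ × ℂ :=
    (ContinuousLinearMap.inr ℂ ℂ ℂ).comp (ContinuousLinearMap.fst ℂ ℂ ℂ)
  let e₂₂ : ℂ × ℂ →L[ℂ] ℂ × ℂ :=
    (ContinuousLinearMap.inr ℂ ℂ ℂ).comp (ContinuousLinearMap.snd ℂ ℂ ℂ)
  refine ⟨fun x => (f x.1 * (u x.1)⁻¹, (θ x.2 + g x.1) * (u x.1)⁻¹),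
    fun x => p x • e₁₁ + q x • e₂₁ + s x • e₂₂,
    -- The form is forced by `F`: comparing ∂w-∂w terms gives 2α(∂w) = c - k = 2d, and the mixed
    -- terms then give α(∂z) = b + u'/u.
    fun x => (b x.1 + u' x.1 * (u x.1)⁻¹) • ContinuousLinearMap.fst ℂ ℂ ℂ
      + d • ContinuousLinearMap.snd ℂ ℂ ℂ, ?_, ?_, ?_⟩
  · ext <;> simp [p, q, s, e₁₁, e₂₁, e₂₂, hu0, hu0', hf0, hf0', hg0, hg0', hθ0, hθ0']
  · have hA : ∀ {h h₁ h₂ : ℂ → ℂ}, (∀ᶠ z in 𝓝 z₀, HasDerivAt h (h₁ z) z ∧ HasDerivAt h₁ (h₂ z) z) →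
        ∀ᶠ z in 𝓝 z₀, ContDiffAt ℂ ω h z := fun hh => by
      filter_upwards [hh.eventually_nhds] with z hz
      exact (Complex.analyticAt_iff_eventually_differentiableAt.2
        (hz.mono fun _ hw => hw.1.differentiableAt)).contDiffAt
    have hθω : ContDiff ℂ ω θ :=
      Differentiable.contDiff fun w => (hθ w).differentiableAt
    filter_upwards [hfst.eventually (hA hu), hfst.eventually (hA hf), hfst.eventually (hA hg),
      hfst.eventually hune] with x hu hf hg hune
    have du := hu.comp x contDiffAt_fst
    have dm := du.inv hune
    exact ((hf.comp x contDiffAt_fst).mul dm).prodMk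
      (((hθω.contDiffAt.comp x contDiffAt_snd).add (hg.comp x contDiffAt_fst)).mul dm)
  · filter_upwards [hfst.eventually hu, hfst.eventually hf, hfst.eventually hg,
      hfst.eventually hune] with x hu hf hg hune
    have hF : HasFDerivAt (Prod.fst : ℂ × ℂ → ℂ) (ContinuousLinearMap.fst ℂ ℂ ℂ) x :=
      hasFDerivAt_fst
    have hS : HasFDerivAt (Prod.snd : ℂ × ℂ → ℂ) (ContinuousLinearMap.snd ℂ ℂ ℂ) x :=
      hasFDerivAt_snd
    have du := hu.1.comp_hasFDerivAt x hF
    have du' := hu.2.comp_hasFDerivAt x hF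
    have df := hf.1.comp_hasFDerivAt x hF
    have df' := hf.2.comp_hasFDerivAt x hF
    have dg := hg.1.comp_hasFDerivAt x hF
    have dg' := hg.2.comp_hasFDerivAt x hF
    have dm := (hu.1.inv hune).comp_hasFDerivAt x hF
    have dθ := (hθ x.2).comp_hasFDerivAt x hS
    have dθ' := (hθ' x.2).comp_hasFDerivAt x hS
    have dp := (df'.sub ((df.mul du').mul dm)).mul dm
    have dq := (dg'.sub (((dθ.add dg).mul du').mul dm)).mul dm
    have ds := dθ'.mul dm
    refine ⟨?_, _, (((dp.smul_const e₁₁).add (dq.smul_const e₂₁)).add (ds.smul_const e₂₂)), ?_⟩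
    · refine ((df.mul dm).prodMk ((dθ.add dg).mul dm)).congr_fderiv ?_
      ext <;> simp [p, q, s, e₁₁, e₂₁, e₂₂] <;> field_simp <;> ring
    · intro v y
      have hw := hθk x.2
      ext
      · simp [p, q, s, e₁₁, e₂₁, e₂₂, christoffelForm]
        field_simp
        ring
      · simp [p, q, s, e₁₁, e₂₁, e₂₂, christoffelForm]
        rw [hw]
        field_simp
        simp only [hk]
        ring

end LocalLinearization

/-! ### Affine connections in coordinates -/

section Coordinates

variable {V : Type*} [NormedAddCommGroup V] [NormedSpace ℂ V]
  {M : Type*} [TopologicalSpace M] [ChartedSpace V M]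

/-- The vector field whose expression in the chart `ψ` is the constant `u`. -/
noncomputable def coordField (ψ : M → V) (u : V) (x : M) : TangentSpace 𝓘(ℂ, V) x :=
  (vderiv ψ x).inverse u

theorem coordField_add (ψ : M → V) (u v : V) :
    coordField ψ (u + v) = coordField ψ u + coordField ψ v := by
  funext x
  exact map_add _ _ _

theorem coordField_smul (ψ : M → V) (c : ℂ) (u : V) :
    coordField ψ (c • u) = c • coordField ψ u := by
  funext x
  exact map_smul _ _ _

theorem vderiv_congr {f g : M → V} {x : M} (h : f =ᶠ[𝓝 x] g) : vderiv f x = vderiv g x :=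
  h.mfderiv_eq

theorem vderiv_comp {F : V → V} {F' : V →L[ℂ] V} {f : M → V} {x : M}
    (hF : HasFDerivAt F F' (f x)) (hf : MDifferentiableAt 𝓘(ℂ, V) 𝓘(ℂ, V) f x)
    (v : TangentSpace 𝓘(ℂ, V) x) :
    vderiv (fun y => F (f y)) x v = F' (vderiv f x v) := by
  have h := (hF.hasMFDerivAt.comp x hf.hasMFDerivAt).mfderiv
  exact congrArg (fun T : TangentSpace 𝓘(ℂ, V) x →L[ℂ] V => T v) h

theorem contMDiffAt_chart {ψ : OpenPartialHomeomorph M V}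
    (hψ : ψ ∈ IsManifold.maximalAtlas 𝓘(ℂ, V) ω M) {x : M} (hx : x ∈ ψ.source) :
    ContMDiffAt 𝓘(ℂ, V) 𝓘(ℂ, V) ω ψ x :=
  contMDiffAt_of_mem_maximalAtlas hψ hx

theorem mdifferentiable_chart_of_mem {ψ : OpenPartialHomeomorph M V}
    (hψ : ψ ∈ IsManifold.maximalAtlas 𝓘(ℂ, V) ω M) :
    ψ.MDifferentiable 𝓘(ℂ, V) 𝓘(ℂ, V) :=
  ⟨(contMDiffOn_of_mem_maximalAtlas hψ).mdifferentiableOn (by simp),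
    (contMDiffOn_symm_of_mem_maximalAtlas hψ).mdifferentiableOn (by simp)⟩

theorem isInvertible_vderiv {ψ : OpenPartialHomeomorph M V}
    (hψ : ψ ∈ IsManifold.maximalAtlas 𝓘(ℂ, V) ω M) {x : M} (hx : x ∈ ψ.source) :
    (vderiv ψ x).IsInvertible :=
  ⟨(mdifferentiable_chart_of_mem hψ).mfderiv hx, rfl⟩

theorem vderiv_coordField {ψ : OpenPartialHomeomorph M V}
    (hψ : ψ ∈ IsManifold.maximalAtlas 𝓘(ℂ, V) ω M) {x : M} (hx : x ∈ ψ.source) (u : V) :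
    vderiv ψ x (coordField ψ u x) = u :=
  (isInvertible_vderiv hψ hx).self_apply_inverse u

theorem coordField_vderiv {ψ : OpenPartialHomeomorph M V}
    (hψ : ψ ∈ IsManifold.maximalAtlas 𝓘(ℂ, V) ω M) {x : M} (hx : x ∈ ψ.source)
    (v : TangentSpace 𝓘(ℂ, V) x) :
    coordField ψ (vderiv ψ x v) x = v :=
  (isInvertible_vderiv hψ hx).inverse_apply_self v

variable [IsManifold 𝓘(ℂ, V) ω M]

/-- The differential of `f` is a holomorphic bundle map, and the fibre coordinate on the tangent
bundle of the vector space `V` is holomorphic. -/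
theorem mdifferentiableAt_vderiv_apply {f : M → V} {x : M}
    (hf : ContMDiffAt 𝓘(ℂ, V) 𝓘(ℂ, V) ω f x) {Y : ∀ y : M, TangentSpace 𝓘(ℂ, V) y}
    (hY : MDifferentiableAt 𝓘(ℂ, V) (𝓘(ℂ, V).prod 𝓘(ℂ, V))
      (fun y => (⟨y, Y y⟩ : TotalSpace V (TangentSpace 𝓘(ℂ, V) : M → Type _))) x) :
    MDifferentiableAt 𝓘(ℂ, V) 𝓘(ℂ, V) (fun y => vderiv f y (Y y)) x := by
  have h1 : MDifferentiableAt 𝓘(ℂ, V) 𝓘(ℂ, V →L[ℂ] V)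
      (inTangentCoordinates 𝓘(ℂ, V) 𝓘(ℂ, V) id f (mfderiv 𝓘(ℂ, V) 𝓘(ℂ, V) f) x) x :=
    (hf.mfderiv_const (m := ω) (by simp)).mdifferentiableAt (by simp)
  have h2 := MDifferentiableAt.clm_apply_of_inCoordinates h1 hY
    (hf.mdifferentiableAt (by simp))
  have h3 := (contMDiff_snd_tangentBundle_modelSpace V 𝓘(ℂ, V) (n := 1)).mdifferentiable
    (by simp)
  exact (h3 _).comp x h2

variable [CompleteSpace V]

theorem contMDiffOn_coordField {ψ : OpenPartialHomeomorph M V}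
    (hψ : ψ ∈ IsManifold.maximalAtlas 𝓘(ℂ, V) ω M) (u : V) :
    ContMDiffOn 𝓘(ℂ, V) (𝓘(ℂ, V).prod 𝓘(ℂ, V)) ω
      (fun y => (⟨y, coordField ψ u y⟩ : TotalSpace V (TangentSpace 𝓘(ℂ, V) : M → Type _)))
      ψ.source := by
  intro x hx
  have hc : ContMDiffAt 𝓘(ℂ, V) (𝓘(ℂ, V).prod 𝓘(ℂ, V)) ω
      (fun y => (⟨y, u⟩ : TotalSpace V (TangentSpace 𝓘(ℂ, V) : V → Type _))) (ψ x) :=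
    contMDiffAt_vectorSpace_iff_contDiffAt.2 contDiffAt_const
  exact (ContMDiffAt.mpullback_vectorField_preimage hc (contMDiffAt_chart hψ hx)
    (isInvertible_vderiv hψ hx) (by simp)).contMDiffWithinAt

theorem mdifferentiableAt_coordField {ψ : OpenPartialHomeomorph M V}
    (hψ : ψ ∈ IsManifold.maximalAtlas 𝓘(ℂ, V) ω M) {x : M} (hx : x ∈ ψ.source) (u : V) :
    MDifferentiableAt 𝓘(ℂ, V) (𝓘(ℂ, V).prod 𝓘(ℂ, V))
      (fun y => (⟨y, coordField ψ u y⟩ : TotalSpace V (TangentSpace 𝓘(ℂ, V) : M → Type _))) x :=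
  ((contMDiffOn_coordField hψ u).contMDiffAt (ψ.open_source.mem_nhds hx)).mdifferentiableAt
    (by simp)

/-- Coordinate fields are pull-backs of constant fields, and the bracket commutes with pull-back. -/
theorem mlieBracket_coordField {ψ : OpenPartialHomeomorph M V}
    (hψ : ψ ∈ IsManifold.maximalAtlas 𝓘(ℂ, V) ω M) {x : M} (hx : x ∈ ψ.source) (u v : V) :
    VectorField.mlieBracket 𝓘(ℂ, V) (coordField ψ u) (coordField ψ v) x = 0 := by
  have hc : ∀ u : V, MDifferentiableAt 𝓘(ℂ, V) (𝓘(ℂ, V).prod 𝓘(ℂ, V))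
      (fun y => (⟨y, u⟩ : TotalSpace V (TangentSpace 𝓘(ℂ, V) : V → Type _))) (ψ x) := fun u =>
    (contMDiffAt_vectorSpace_iff_contDiffAt (n := 1).2 contDiffAt_const).mdifferentiableAt
      (by simp)
  have h := VectorField.mpullback_mlieBracket (hc u) (hc v) (contMDiffAt_chart hψ hx)
    (by simp [minSmoothness_of_isRCLikeNormedField])
  refine Eq.trans h.symm ?_
  have h0 : VectorField.lieBracketWithin ℂ (fun _ : V => u) (fun _ : V => v) univ = 0 := by
    funext y
    simp [VectorField.lieBracketWithin]
  have h1 := (VectorField.mlieBracketWithin_eq_lieBracketWithin (𝕜 := ℂ) (V := fun _ : V => u)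
    (W := fun _ : V => v) (s := univ)).trans h0
  refine (congrArg (vderiv ψ x).inverse (congrFun h1 (ψ x))).trans ?_
  exact map_zero _

end Coordinates

/-! ### Christoffel symbols in a chart -/

section Christoffel

variable {M : Type*} [TopologicalSpace M] [ChartedSpace (ℂ × ℂ) M] [IsManifold 𝓘(ℂ, ℂ × ℂ) ω M]

/-- The Christoffel symbols of a connection in the chart `ψ`, as a bilinear map. -/
noncomputable def christoffel
    (D : CovariantDerivative 𝓘(ℂ, ℂ × ℂ) (ℂ × ℂ) (TangentSpace 𝓘(ℂ, ℂ × ℂ) : M → Type _))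
    (ψ : M → ℂ × ℂ) (x : M) (v y : ℂ × ℂ) : ℂ × ℂ :=
  vderiv ψ x (D (coordField ψ y) x (coordField ψ v x))

variable {D : CovariantDerivative 𝓘(ℂ, ℂ × ℂ) (ℂ × ℂ) (TangentSpace 𝓘(ℂ, ℂ × ℂ) : M → Type _)}
  {ψ : OpenPartialHomeomorph M (ℂ × ℂ)}

theorem christoffel_left (x : M) (v y : ℂ × ℂ) :
    christoffel D ψ x v y =
      v.1 • christoffel D ψ x (1, 0) y + v.2 • christoffel D ψ x (0, 1) y := by
  have hv : v = v.1 • (1, 0) + v.2 • (0, 1) := by ext <;> simp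
  conv_lhs => rw [hv]
  simp only [christoffel, coordField_add, coordField_smul, Pi.add_apply, Pi.smul_apply, map_add,
    map_smul]

theorem christoffel_right (hψ : ψ ∈ IsManifold.maximalAtlas 𝓘(ℂ, ℂ × ℂ) ω M) {x : M}
    (hx : x ∈ ψ.source) (v y : ℂ × ℂ) :
    christoffel D ψ x v y =
      y.1 • christoffel D ψ x v (1, 0) + y.2 • christoffel D ψ x v (0, 1) := by
  have hy : y = y.1 • (1, 0) + y.2 • (0, 1) := by ext <;> simp
  have h : ∀ u, MDifferentiableAt 𝓘(ℂ, ℂ × ℂ) (𝓘(ℂ, ℂ × ℂ).prod 𝓘(ℂ, ℂ × ℂ))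
      (fun y => (⟨y, coordField ψ u y⟩ :
        TotalSpace (ℂ × ℂ) (TangentSpace 𝓘(ℂ, ℂ × ℂ) : M → Type _))) x := fun u =>
    mdifferentiableAt_coordField hψ hx u
  have h2 : ∀ (c : ℂ) u, MDifferentiableAt 𝓘(ℂ, ℂ × ℂ) (𝓘(ℂ, ℂ × ℂ).prod 𝓘(ℂ, ℂ × ℂ))
      (fun y => (⟨y, (c • coordField ψ u) y⟩ :
        TotalSpace (ℂ × ℂ) (TangentSpace 𝓘(ℂ, ℂ × ℂ) : M → Type _))) x := fun c u => by
    rw [← coordField_smul]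
    exact h _
  conv_lhs => rw [hy]
  simp only [christoffel, coordField_add, coordField_smul]
  rw [D.isCovariantDerivativeOnUniv.add (h2 _ _) (h2 _ _),
    D.isCovariantDerivativeOnUniv.smul_const _ (h _),
    D.isCovariantDerivativeOnUniv.smul_const _ (h _)]
  simp

/-- The covariant derivative in coordinates. -/
theorem vderiv_connection (hψ : ψ ∈ IsManifold.maximalAtlas 𝓘(ℂ, ℂ × ℂ) ω M) {x : M}
    (hx : x ∈ ψ.source) {Y : ∀ y : M, TangentSpace 𝓘(ℂ, ℂ × ℂ) y}
    (hY : MDifferentiableAt 𝓘(ℂ, ℂ × ℂ) (𝓘(ℂ, ℂ × ℂ).prod 𝓘(ℂ, ℂ × ℂ))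
      (fun y => (⟨y, Y y⟩ : TotalSpace (ℂ × ℂ) (TangentSpace 𝓘(ℂ, ℂ × ℂ) : M → Type _))) x)
    (v : TangentSpace 𝓘(ℂ, ℂ × ℂ) x) :
    vderiv ψ x (D Y x v) = vderiv (fun y => vderiv ψ y (Y y)) x v
      + christoffel D ψ x (vderiv ψ x v) (vderiv ψ x (Y x)) := by
  have hD := D.isCovariantDerivativeOnUniv
  set η : M → ℂ × ℂ := fun y => vderiv ψ y (Y y) with hη
  have hηd : MDifferentiableAt 𝓘(ℂ, ℂ × ℂ) 𝓘(ℂ, ℂ × ℂ) η x :=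
    mdifferentiableAt_vderiv_apply (contMDiffAt_chart hψ hx) hY
  have hfst : HasMFDerivAt 𝓘(ℂ, ℂ × ℂ) 𝓘(ℂ, ℂ) (fun y => (η y).1) x
      ((ContinuousLinearMap.fst ℂ ℂ ℂ).comp (vderiv η x)) :=
    (hasFDerivAt_fst.hasMFDerivAt).comp x hηd.hasMFDerivAt
  have hsnd : HasMFDerivAt 𝓘(ℂ, ℂ × ℂ) 𝓘(ℂ, ℂ) (fun y => (η y).2) x
      ((ContinuousLinearMap.snd ℂ ℂ ℂ).comp (vderiv η x)) :=
    (hasFDerivAt_snd.hasMFDerivAt).comp x hηd.hasMFDerivAt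
  have hE : ∀ u, MDifferentiableAt 𝓘(ℂ, ℂ × ℂ) (𝓘(ℂ, ℂ × ℂ).prod 𝓘(ℂ, ℂ × ℂ))
      (fun y => (⟨y, coordField ψ u y⟩ :
        TotalSpace (ℂ × ℂ) (TangentSpace 𝓘(ℂ, ℂ × ℂ) : M → Type _))) x := fun u =>
    mdifferentiableAt_coordField hψ hx u
  have h1 := hfst.mdifferentiableAt.smul_section (hE (1, 0))
  have h2 := hsnd.mdifferentiableAt.smul_section (hE (0, 1))
  -- Expand `Y` in the coordinate frame, so that the Leibniz rule applies.
  have heq : ∀ᶠ y in 𝓝 x, Y y = ((fun y => (η y).1) • coordField ψ (1, 0)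
      + (fun y => (η y).2) • coordField ψ (0, 1)) y := by
    filter_upwards [ψ.open_source.mem_nhds hx] with y hy
    have hv : η y = (η y).1 • (1, 0) + (η y).2 • (0, 1) := by ext <;> simp
    have := coordField_vderiv hψ hy (Y y)
    rw [← this]
    show coordField ψ (η y) y = _
    conv_lhs => rw [hv]
    rw [coordField_add, coordField_smul, coordField_smul]
    rfl
  rw [hD.congr_of_eventuallyEq hY (mdifferentiableAt_add_section h1 h2) Filter.univ_mem heq, hD.add h1 h2,
    hD.leibniz (hE _) hfst.mdifferentiableAt, hD.leibniz (hE _) hsnd.mdifferentiableAt]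
  have hd1 : ∀ v, mvfderiv 𝓘(ℂ, ℂ × ℂ) (fun y => (η y).1) x v = (vderiv η x v).1 := fun v =>
    congrArg (fun T : TangentSpace 𝓘(ℂ, ℂ × ℂ) x →L[ℂ] ℂ => T v) hfst.mfderiv
  have hd2 : ∀ v, mvfderiv 𝓘(ℂ, ℂ × ℂ) (fun y => (η y).2) x v = (vderiv η x v).2 := fun v =>
    congrArg (fun T : TangentSpace 𝓘(ℂ, ℂ × ℂ) x →L[ℂ] ℂ => T v) hsnd.mfderiv
  rw [christoffel_right hψ hx]
  simp only [christoffel, coordField_vderiv hψ hx]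
  simp only [add_apply, smul_apply, map_add, map_smul,
    ContinuousLinearMap.smulRight_apply, vderiv_coordField hψ hx, hd1, hd2]
  ext <;> simp [hη] <;> ring

/-- Coordinate fields commute, so vanishing torsion is symmetry of the symbols. -/
theorem christoffel_symm (hψ : ψ ∈ IsManifold.maximalAtlas 𝓘(ℂ, ℂ × ℂ) ω M)
    (hT : D.torsion = 0) {x : M} (hx : x ∈ ψ.source) (v y : ℂ × ℂ) :
    christoffel D ψ x v y = christoffel D ψ x y v := by
  have h := D.torsion_eq_zero_iff.1 hT (mdifferentiableAt_coordField hψ hx v)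
    (mdifferentiableAt_coordField hψ hx y)
  rw [mlieBracket_coordField hψ hx, sub_eq_zero] at h
  simp only [christoffel, h]

/-- The covariant derivative of a holomorphic vector field along a holomorphic vector field is
holomorphic. -/
theorem mdifferentiableAt_connection (hD : IsHolomorphicConnection D) {U : Set M} (hU : IsOpen U)
    {Y W : ∀ y : M, TangentSpace 𝓘(ℂ, ℂ × ℂ) y}
    (hY : ContMDiffOn 𝓘(ℂ, ℂ × ℂ) (𝓘(ℂ, ℂ × ℂ).prod 𝓘(ℂ, ℂ × ℂ)) ω
      (fun y => (⟨y, Y y⟩ : TotalSpace (ℂ × ℂ) (TangentSpace 𝓘(ℂ, ℂ × ℂ) : M → Type _))) U)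
    (hW : ContMDiffOn 𝓘(ℂ, ℂ × ℂ) (𝓘(ℂ, ℂ × ℂ).prod 𝓘(ℂ, ℂ × ℂ)) ω
      (fun y => (⟨y, W y⟩ : TotalSpace (ℂ × ℂ) (TangentSpace 𝓘(ℂ, ℂ × ℂ) : M → Type _))) U)
    {x : M} (hx : x ∈ U) :
    MDifferentiableAt 𝓘(ℂ, ℂ × ℂ) (𝓘(ℂ, ℂ × ℂ).prod 𝓘(ℂ, ℂ × ℂ))
      (fun y => (⟨y, D Y y (W y)⟩ :
        TotalSpace (ℂ × ℂ) (TangentSpace 𝓘(ℂ, ℂ × ℂ) : M → Type _))) x := by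
  have h := (hD U hU).contMDiff (σ := Y) (by simpa using hY)
  exact ((h.clm_bundle_apply hW).contMDiffAt (hU.mem_nhds hx)).mdifferentiableAt (by simp)

theorem mdifferentiableAt_christoffel (hD : IsHolomorphicConnection D)
    (hψ : ψ ∈ IsManifold.maximalAtlas 𝓘(ℂ, ℂ × ℂ) ω M) {x : M} (hx : x ∈ ψ.source)
    (v y : ℂ × ℂ) :
    MDifferentiableAt 𝓘(ℂ, ℂ × ℂ) 𝓘(ℂ, ℂ × ℂ) (fun x => christoffel D ψ x v y) x :=
  mdifferentiableAt_vderiv_apply (contMDiffAt_chart hψ hx)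
    (mdifferentiableAt_connection hD ψ.open_source (contMDiffOn_coordField hψ y)
      (contMDiffOn_coordField hψ v) hx)

/-- The Christoffel symbols depend only on the differential of the chart. -/
theorem christoffel_congr (hψ : ψ ∈ IsManifold.maximalAtlas 𝓘(ℂ, ℂ × ℂ) ω M)
    {ψ' : OpenPartialHomeomorph M (ℂ × ℂ)} (hψ' : ψ' ∈ IsManifold.maximalAtlas 𝓘(ℂ, ℂ × ℂ) ω M)
    {x : M} (hx : x ∈ ψ.source) (hx' : x ∈ ψ'.source)
    (h : ∀ᶠ y in 𝓝 x, vderiv ψ y = vderiv ψ' y) (v y : ℂ × ℂ) :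
    christoffel D ψ x v y = christoffel D ψ' x v y := by
  have hc : ∀ u, ∀ᶠ y in 𝓝 x, coordField ψ u y = coordField ψ' u y := fun u => by
    filter_upwards [h] with y hy
    simp only [coordField, hy]
  have := D.isCovariantDerivativeOnUniv.congr_of_eventuallyEq
    (mdifferentiableAt_coordField hψ hx y) (mdifferentiableAt_coordField hψ' hx' y)
    Filter.univ_mem (hc y)
  simp only [christoffel, this, h.self_of_nhds, (hc v).self_of_nhds]

end Christoffel

/-! ### From the local model to flat charts on the manifold -/

section Flatness

variable {M : Type*} [TopologicalSpace M] [ChartedSpace (ℂ × ℂ) M] [IsManifold 𝓘(ℂ, ℂ × ℂ) ω M]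
  {D : CovariantDerivative 𝓘(ℂ, ℂ × ℂ) (ℂ × ℂ) (TangentSpace 𝓘(ℂ, ℂ × ℂ) : M → Type _)}
  {ψ : OpenPartialHomeomorph M (ℂ × ℂ)}

theorem christoffel_eq_form (hψ : ψ ∈ IsManifold.maximalAtlas 𝓘(ℂ, ℂ × ℂ) ω M)
    (hT : D.torsion = 0) {x : M} (hx : x ∈ ψ.source) {c d : ℂ}
    (hc : christoffel D ψ x (0, 1) (0, 1) = (0, c))
    (hd : (christoffel D ψ x (1, 0) (0, 1)).1 = d) (v y : ℂ × ℂ) :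
    christoffel D ψ x v y = christoffelForm (christoffel D ψ x (1, 0) (1, 0)).1
      (christoffel D ψ x (1, 0) (0, 1)).2 c d (christoffel D ψ x (1, 0) (1, 0)).2 v y := by
  rw [christoffel_left, christoffel_right hψ hx (1, 0), christoffel_right hψ hx (0, 1),
    christoffel_symm hψ hT hx (0, 1) (1, 0), hc, christoffelForm, ← hd]
  ext <;> simp <;> ring

/-- Postcomposition of a chart with a local biholomorphism. -/
theorem exists_chart_comp (hψ : ψ ∈ IsManifold.maximalAtlas 𝓘(ℂ, ℂ × ℂ) ω M) {p : M}
    (hp : p ∈ ψ.source) {F : ℂ × ℂ → ℂ × ℂ}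
    (hF : ContDiffAt ℂ ω F (ψ p)) {e : (ℂ × ℂ) ≃L[ℂ] (ℂ × ℂ)}
    (hFe : HasFDerivAt F (e : ℂ × ℂ →L[ℂ] ℂ × ℂ) (ψ p)) {N : Set (ℂ × ℂ)} (hN : IsOpen N)
    (hpN : ψ p ∈ N) (hNF : ∀ x ∈ N, ContDiffAt ℂ ω F x ∧
      ∃ e : (ℂ × ℂ) ≃L[ℂ] (ℂ × ℂ), HasFDerivAt F (e : ℂ × ℂ →L[ℂ] ℂ × ℂ) x) :
    ∃ φ ∈ IsManifold.maximalAtlas 𝓘(ℂ, ℂ × ℂ) ω M, p ∈ φ.source ∧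
      φ.source ⊆ ψ.source ∩ ψ ⁻¹' N ∧ ∀ x, φ x = F (ψ x) := by
  let G := (hF.toOpenPartialHomeomorph F hFe (by simp)).restrOpen N hN
  have hGs : G.source ⊆ N := fun x hx => hx.2
  have hGc : ∀ x, G x = F x := fun x => rfl
  have hpG : ψ p ∈ G.source := ⟨hF.mem_toOpenPartialHomeomorph_source hFe (by simp), hpN⟩
  refine ⟨ψ.trans G, ?_, ⟨hp, hpG⟩, fun x hx => ⟨hx.1, hGs hx.2⟩, fun x => rfl⟩
  rw [IsManifold.mem_maximalAtlas_iff_contMDiffOn]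
  constructor
  · intro x hx
    exact ((hNF _ (hGs hx.2)).1.contMDiffAt.comp x (contMDiffAt_chart hψ hx.1)).contMDiffWithinAt
  · intro y hy
    have hy1 : y ∈ G.target := hy.1
    have hy2 : G.symm y ∈ ψ.target := hy.2
    obtain ⟨h1, e', h2⟩ := hNF _ (hGs (G.map_target hy1))
    have h3 : ContDiffAt ℂ ω G.symm y := G.contDiffAt_symm hy1 h2 h1
    exact (((contMDiffOn_symm_of_mem_maximalAtlas hψ).contMDiffAt
      (ψ.open_target.mem_nhds hy2)).comp y h3.contMDiffAt).contMDiffWithinAt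

/-- If in a chart the Christoffel symbols depend on the first coordinate only, the second
coordinate lines are geodesics, and two of the Christoffel symbols are constant, then the
connection is projectively flat near every point of the chart. -/
theorem exists_flat_chart (hD : IsHolomorphicConnection D) (hT : D.torsion = 0)
    (hψ : ψ ∈ IsManifold.maximalAtlas 𝓘(ℂ, ℂ × ℂ) ω M) {p : M} (hp : p ∈ ψ.source) {c d : ℂ}
    (hc : ∀ x ∈ ψ.source, christoffel D ψ x (0, 1) (0, 1) = (0, c))
    (hd : ∀ x ∈ ψ.source, (christoffel D ψ x (1, 0) (0, 1)).1 = d)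
    (hz : ∀ x ∈ ψ.source, ∀ x' ∈ ψ.source, (ψ x).1 = (ψ x').1 →
      ∀ v y, christoffel D ψ x v y = christoffel D ψ x' v y) :
    ∃ φ ∈ IsManifold.maximalAtlas 𝓘(ℂ, ℂ × ℂ) ω M, p ∈ φ.source ∧
      ∃ α : ∀ x : M, TangentSpace 𝓘(ℂ, ℂ × ℂ) x →L[ℂ] ℂ,
        ∀ x ∈ φ.source, ∀ Y : (∀ y : M, TangentSpace 𝓘(ℂ, ℂ × ℂ) y),
          MDifferentiableAt 𝓘(ℂ, ℂ × ℂ) (𝓘(ℂ, ℂ × ℂ).prod 𝓘(ℂ, ℂ × ℂ))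
            (fun y => (⟨y, Y y⟩ :
              TotalSpace (ℂ × ℂ) (TangentSpace 𝓘(ℂ, ℂ × ℂ) : M → Type _))) x →
          ∀ v : TangentSpace 𝓘(ℂ, ℂ × ℂ) x,
            vderiv φ x (D Y x v) =
              vderiv (fun y => vderiv φ y (Y y)) x v
                + α x v • vderiv φ x (Y x) + α x (Y x) • vderiv φ x v := by
  set z₀ := (ψ p).1 with hz₀
  set w₀ := (ψ p).2 with hw₀
  have hcont : Continuous fun z : ℂ => (z, w₀) := by fun_prop
  have hslice : ∀ᶠ z in 𝓝 z₀, (z, w₀) ∈ ψ.target :=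
    hcont.continuousAt.eventually (ψ.open_target.mem_nhds (ψ.map_source hp))
  -- The symbols become functions of z alone by restriction to the slice w = w₀.
  have hdiff : ∀ v y, ∀ᶠ z in 𝓝 z₀,
      DifferentiableAt ℂ (fun z => christoffel D ψ (ψ.symm (z, w₀)) v y) z := fun v y => by
    filter_upwards [hslice] with z hzt
    have h1 := mdifferentiableAt_christoffel hD hψ (ψ.map_target hzt) v y
    have h2 := (mdifferentiable_chart_of_mem hψ).mdifferentiableAt_symm hzt
    have h3 : MDifferentiableAt 𝓘(ℂ, ℂ) 𝓘(ℂ, ℂ × ℂ) (fun z : ℂ => (z, w₀)) z :=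
      (differentiableAt_id.prodMk (differentiableAt_const _)).mdifferentiableAt
    exact mdifferentiableAt_iff_differentiableAt.1
      (h1.comp z (MDifferentiableAt.comp z h2 h3))
  have hfst : ∀ v y, ∀ᶠ z in 𝓝 z₀,
      DifferentiableAt ℂ (fun z => (christoffel D ψ (ψ.symm (z, w₀)) v y).1) z := fun v y =>
    (hdiff v y).mono fun z h => h.fst
  have hsnd : ∀ v y, ∀ᶠ z in 𝓝 z₀,
      DifferentiableAt ℂ (fun z => (christoffel D ψ (ψ.symm (z, w₀)) v y).2) z := fun v y =>
    (hdiff v y).mono fun z h => h.snd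
  obtain ⟨F, F', β, hF0, hFω, hF⟩ := exists_linearizing_map c d w₀ (hfst (1, 0) (1, 0))
    (hsnd (1, 0) (0, 1)) (hsnd (1, 0) (1, 0))
  have hF'c : ContinuousAt F' (ψ p) := hF.self_of_nhds.2.choose_spec.1.continuousAt
  have hF0' : F' (ψ p) = (ContinuousLinearEquiv.refl ℂ (ℂ × ℂ) : ℂ × ℂ →L[ℂ] ℂ × ℂ) := hF0
  have hinv : ∀ᶠ x in 𝓝 (ψ p), F' x ∈ range
      ((↑) : ((ℂ × ℂ) ≃L[ℂ] (ℂ × ℂ)) → (ℂ × ℂ →L[ℂ] ℂ × ℂ)) :=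
    hF'c.eventually (by rw [hF0']; exact ContinuousLinearEquiv.nhds _)
  -- The chart is shrunk so that every point has a companion on the slice with the same z; `hz`
  -- compares the symbols at the two.
  have hslice' : ∀ᶠ x : ℂ × ℂ in 𝓝 (ψ p), (x.1, w₀) ∈ ψ.target :=
    (continuousAt_fst : ContinuousAt Prod.fst (ψ p)).eventually hslice
  obtain ⟨N, hNsub, hNo, hpN⟩ := eventually_nhds_iff.1 (((hFω.and hF).and hinv).and hslice')
  have hFp : HasFDerivAt F
      (ContinuousLinearEquiv.refl ℂ (ℂ × ℂ) : ℂ × ℂ →L[ℂ] ℂ × ℂ) (ψ p) := by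
    rw [← hF0']
    exact hF.self_of_nhds.1
  obtain ⟨φ, hφ, hpφ, hφs, hφF⟩ := exists_chart_comp hψ hp hFω.self_of_nhds hFp hNo hpN
    fun x hx => by
      obtain ⟨⟨⟨h1, h2, -⟩, ⟨e, he⟩⟩, -⟩ := hNsub x hx
      exact ⟨h1, e, he ▸ h2⟩
  have hφd : ∀ y ∈ φ.source, ∀ v, vderiv φ y v = F' (ψ y) (vderiv ψ y v) := fun y hy v => by
    have h := vderiv_comp (hNsub _ (hφs hy).2).1.1.2.1
      ((contMDiffAt_chart hψ (hφs hy).1).mdifferentiableAt (by simp)) v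
    rw [← h]
    congr 2
    funext y
    exact hφF y
  refine ⟨φ, hφ, hpφ, fun x => (β (ψ x)).comp (vderiv ψ x), fun x hx Y hY v => ?_⟩
  obtain ⟨hxψ, hxN⟩ := hφs hx
  obtain ⟨⟨⟨-, -, F'', hF'', hflat⟩, -⟩, hxt⟩ := hNsub _ hxN
  have hη := mdifferentiableAt_vderiv_apply (contMDiffAt_chart hψ hxψ) hY
  have hψd := (contMDiffAt_chart hψ hxψ).mdifferentiableAt (n := ω) (by simp)
  set η : M → ℂ × ℂ := fun y => vderiv ψ y (Y y) with hηdef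
  have hcongr : (fun y => vderiv φ y (Y y)) =ᶠ[𝓝 x] fun y => F' (ψ y) (η y) := by
    filter_upwards [φ.open_source.mem_nhds hx] with y hy
    exact hφd y hy _
  have hprod : HasFDerivAt (fun q : (ℂ × ℂ) × (ℂ × ℂ) => F' q.1 q.2) _ (ψ x, η x) :=
    HasFDerivAt.clm_apply (hF''.comp (ψ x, η x) hasFDerivAt_fst) hasFDerivAt_snd
  have hpair : HasMFDerivAt 𝓘(ℂ, ℂ × ℂ) 𝓘(ℂ, (ℂ × ℂ) × (ℂ × ℂ)) (fun y => (ψ y, η y)) x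
      ((vderiv ψ x).prod (vderiv η x)) :=
    ⟨hψd.continuousAt.prodMk hη.continuousAt,
      hψd.hasMFDerivAt.2.prodMk hη.hasMFDerivAt.2⟩
  have hder := (HasMFDerivAt.comp (f := fun y => (ψ y, η y)) x hprod.hasMFDerivAt hpair).mfderiv
  -- The second derivative of `F` enters here, as the change of the Christoffel symbols under the
  -- change of coordinates.
  have hder' : vderiv (fun y => F' (ψ y) (η y)) x v
      = F' (ψ x) (vderiv η x v) + F'' (vderiv ψ x v) (η x) :=
    congrArg (fun T : TangentSpace 𝓘(ℂ, ℂ × ℂ) x →L[ℂ] ℂ × ℂ => T v) hder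
  have hsym : ψ.symm ((ψ x).1, w₀) ∈ ψ.source := ψ.map_target hxt
  have hz1 : (ψ x).1 = (ψ (ψ.symm ((ψ x).1, w₀))).1 := by rw [ψ.right_inv hxt]
  have hform := christoffel_eq_form hψ hT hsym (hc _ hsym) (hd _ hsym) (vderiv ψ x v) (η x)
  rw [← hz x hxψ _ hsym hz1] at hform
  rw [vderiv_congr hcongr, hder', hφd x hx, hφd x hx, hφd x hx, vderiv_connection hψ hxψ hY,
    map_add, hform, hflat]
  simp only [ContinuousLinearMap.comp_apply, hηdef]
  abel

end Flatness

/-! ### Translation-invariant connections on the plane -/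

section TranslationInvariant

/-- A quadratic map of the plane to itself has an eigenvector, which a linear change of coordinates
moves to the second basis vector. -/
theorem exists_linearEquiv_eigenvector (P S R : ℂ × ℂ) :
    ∃ (L : (ℂ × ℂ) ≃L[ℂ] (ℂ × ℂ)) (c : ℂ), ∀ n, n = L.symm (0, 1) →
      L ((n.1 * n.1) • P + (n.1 * n.2) • S + (n.2 * n.2) • R) = (0, c) := by
  -- If `P.2 = 0`, then (1, 0) is already an eigenvector and the coordinates are swapped. Otherwise
  -- (t, 1) is one exactly when t is a root of the cubic `f`, whose leading coefficient is nonzero.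
  by_cases hP : P.2 = 0
  · refine ⟨ContinuousLinearEquiv.prodComm ℂ ℂ ℂ, P.1, ?_⟩
    rintro n rfl
    ext <;> simp [hP]
  · let f : Polynomial ℂ := .C (-P.2) * .X ^ 3 + .C (P.1 - S.2) * .X ^ 2 + .C (S.1 - R.2) * .X
      + .C R.1
    have hf : f.degree ≠ 0 := by
      rw [Polynomial.degree_cubic (neg_ne_zero.2 hP)]
      decide
    obtain ⟨t, ht⟩ := IsAlgClosed.exists_root f hf
    simp only [Polynomial.IsRoot, f, Polynomial.eval_add, Polynomial.eval_mul, Polynomial.eval_C,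
      Polynomial.eval_pow, Polynomial.eval_X] at ht
    -- A shear taking (t, 1) to (0, 1).
    let T : (ℂ × ℂ) ≃ₗ[ℂ] (ℂ × ℂ) :=
      { toFun := fun x => (x.1 - t * x.2, x.2)
        invFun := fun x => (x.1 + t * x.2, x.2)
        map_add' := fun x y => by ext <;> simp; ring
        map_smul' := fun a x => by ext <;> simp; ring
        left_inv := fun x => by ext <;> simp
        right_inv := fun x => by ext <;> simp }
    refine ⟨T.toContinuousLinearEquiv, t * t * P.2 + t * S.2 + R.2, ?_⟩
    intro n hn
    have hn' : n = (t, 1) := hn.trans (by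
      show ((0 : ℂ) + t * 1, (1 : ℂ)) = _
      simp)
    subst hn'
    show (_ - t * _, _) = _
    ext
    · simp
      linear_combination ht
    · simp

variable {D : CovariantDerivative 𝓘(ℂ, ℂ × ℂ) (ℂ × ℂ)
  (TangentSpace 𝓘(ℂ, ℂ × ℂ) : ℂ × ℂ → Type _)}

theorem linearChart_mem_maximalAtlas (L : (ℂ × ℂ) ≃L[ℂ] (ℂ × ℂ)) :
    L.toHomeomorph.toOpenPartialHomeomorph ∈
      IsManifold.maximalAtlas 𝓘(ℂ, ℂ × ℂ) ω (ℂ × ℂ) := by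
  rw [IsManifold.mem_maximalAtlas_iff_contMDiffOn]
  exact ⟨L.contDiff.contMDiff.contMDiffOn, L.symm.contDiff.contMDiff.contMDiffOn⟩

/-- Coordinate fields of a linear chart are constant, hence preserved by translations; the
right-hand side does not involve `x`. -/
theorem christoffel_linearChart (hD : IsTranslationInvariant D) (L : (ℂ × ℂ) ≃L[ℂ] (ℂ × ℂ))
    (x v y : ℂ × ℂ) :
    christoffel D L x v y = L (D (fun _ => L.symm y) 0 (L.symm v) : ℂ × ℂ) := by
  have hL : ∀ x : ℂ × ℂ, vderiv L x = (L : ℂ × ℂ →L[ℂ] ℂ × ℂ) := fun x =>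
    mfderiv_eq_fderiv.trans L.fderiv
  have hc : ∀ u : ℂ × ℂ, coordField L u = fun _ => L.symm u := fun u => by
    funext x
    refine (congrArg (fun T : ℂ × ℂ →L[ℂ] ℂ × ℂ => T.inverse u) (hL x)).trans ?_
    rw [ContinuousLinearMap.inverse_equiv]
    rfl
  have h := hD x (fun _ => L.symm y) 0 (L.symm v) (differentiableAt_const _)
  rw [zero_add] at h
  rw [h, christoffel, hc, hc, hL]
  rfl

theorem isProjectivelyFlat_of_isTranslationInvariant (hD : IsHolomorphicConnection D)
    (hT : D.torsion = 0) (hI : IsTranslationInvariant D) : IsProjectivelyFlat D := by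
  let I := ContinuousLinearEquiv.refl ℂ (ℂ × ℂ)
  obtain ⟨L, c, hL⟩ := exists_linearEquiv_eigenvector (christoffel D I 0 (1, 0) (1, 0))
    (christoffel D I 0 (1, 0) (0, 1) + christoffel D I 0 (0, 1) (1, 0))
    (christoffel D I 0 (0, 1) (0, 1))
  have hquad : ∀ n : ℂ × ℂ, christoffel D I 0 n n = (n.1 * n.1) • christoffel D I 0 (1, 0) (1, 0)
      + (n.1 * n.2) • (christoffel D I 0 (1, 0) (0, 1) + christoffel D I 0 (0, 1) (1, 0))
      + (n.2 * n.2) • christoffel D I 0 (0, 1) (0, 1) := fun n => by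
    have hr := fun v y => christoffel_right (D := D) (linearChart_mem_maximalAtlas I)
      (mem_univ (0 : ℂ × ℂ)) v y
    have hl := fun v y => christoffel_left (D := D)
      (ψ := I.toHomeomorph.toOpenPartialHomeomorph) 0 v y
    simp only [Homeomorph.toOpenPartialHomeomorph_apply,
      ContinuousLinearEquiv.coe_toHomeomorph] at hr hl
    rw [hl, hr (1, 0), hr (0, 1)]
    module
  intro p
  refine exists_flat_chart hD hT (linearChart_mem_maximalAtlas L) (mem_univ p) (c := c)
    (d := (christoffel D L 0 (1, 0) (0, 1)).1) (fun x _ => ?_) (fun x _ => ?_)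
    fun x _ x' _ _ v y => ?_
  · refine Eq.trans ?_ (hL _ rfl)
    rw [← hquad]
    exact (christoffel_linearChart hI L x _ _).trans
      (congrArg L (christoffel_linearChart hI I 0 _ _).symm)
  · exact congrArg Prod.fst ((christoffel_linearChart hI L x _ _).trans
      (christoffel_linearChart hI L 0 _ _).symm)
  · exact (christoffel_linearChart hI L x _ _).trans (christoffel_linearChart hI L x' _ _).symm

end TranslationInvariant

/-! ### Elliptic curves -/

section EllipticCurve

variable (L : PeriodPair)

instance ellipticCompactSpace : CompactSpace (EllipticCurveOf L) := by
  have hcont : Continuous fun x : ℝ × ℝ => ((x.1 • L.ω₁ + x.2 • L.ω₂ : ℂ) : EllipticCurveOf L) :=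
    QuotientAddGroup.continuous_mk.comp (by fun_prop)
  have hK : IsCompact (Icc (0 : ℝ) 1 ×ˢ Icc (0 : ℝ) 1) := isCompact_Icc.prod isCompact_Icc
  refine ⟨?_⟩
  -- The closed period parallelogram maps onto the curve: subtract the integer parts of the
  -- coordinates in the period basis.
  convert! hK.image hcont
  refine (eq_univ_of_forall fun q => ?_).symm
  obtain ⟨z, rfl⟩ := QuotientAddGroup.mk_surjective q
  have hz := L.basis.sum_repr z
  rw [Fin.sum_univ_two, L.basis_zero, L.basis_one] at hz
  set a := L.basis.repr z 0
  set b := L.basis.repr z 1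
  refine ⟨(Int.fract a, Int.fract b), ⟨⟨Int.fract_nonneg _, (Int.fract_lt_one _).le⟩,
    ⟨Int.fract_nonneg _, (Int.fract_lt_one _).le⟩⟩, ?_⟩
  refine QuotientAddGroup.eq.2 ?_
  show -_ + z ∈ L.lattice
  refine PeriodPair.mem_lattice.2 ⟨⌊a⌋, ⌊b⌋, ?_⟩
  rw [← hz]
  simp only [Int.fract, Complex.real_smul, Complex.ofReal_sub, Complex.ofReal_intCast]
  ring

instance ellipticConnectedSpace : ConnectedSpace (EllipticCurveOf L) :=
  QuotientAddGroup.mk_surjective.connectedSpace QuotientAddGroup.continuous_mk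

variable {L}

/-- Two charts of an elliptic curve differ locally by a translation. -/
theorem ellipticChart_eventually_eq {e e' : OpenPartialHomeomorph (EllipticCurveOf L) ℂ}
    (he : e ∈ atlas ℂ (EllipticCurveOf L)) (he' : e' ∈ atlas ℂ (EllipticCurveOf L))
    {y : EllipticCurveOf L} (hy : y ∈ e.source) (hy' : y ∈ e'.source) :
    ∃ k : ℂ, ∀ᶠ x in 𝓝 y, e' x = e x + k := by
  have hmem : ∀ᶠ x in 𝓝 y, e' x - e x ∈ L.lattice := by
    filter_upwards [e.open_source.mem_nhds hy, e'.open_source.mem_nhds hy'] with x hx hx'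
    have h1 := mk_ellipticChart L he (e.map_source hx)
    have h2 := mk_ellipticChart L he' (e'.map_source hx')
    rw [e.left_inv hx] at h1
    rw [e'.left_inv hx'] at h2
    have h3 := QuotientAddGroup.eq.1 (h1.symm.trans h2)
    rwa [neg_add_eq_sub] at h3
  -- The difference of the charts is continuous with values in a discrete lattice, hence locally
  -- constant.
  obtain ⟨N, hN, hNL⟩ : ∃ N ∈ 𝓝 (e' y - e y), N ∩ (L.lattice : Set ℂ) ⊆ {e' y - e y} := by
    have hd : DiscreteTopology (L.lattice : Set ℂ) :=
      inferInstanceAs (DiscreteTopology L.lattice)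
    obtain ⟨N, hN, h⟩ := (mem_nhds_induced _ _ _).mp
      ((isOpen_discrete ({⟨_, hmem.self_of_nhds⟩} : Set (L.lattice : Set ℂ))).mem_nhds rfl)
    exact ⟨N, hN, fun y hy => congrArg Subtype.val
      (h (show (⟨y, hy.2⟩ : (L.lattice : Set ℂ)) ∈ Subtype.val ⁻¹' N from hy.1))⟩
  have hcont : ContinuousAt (fun x => e' x - e x) y :=
    (e'.continuousAt hy').sub (e.continuousAt hy)
  refine ⟨e' y - e y, ?_⟩
  filter_upwards [hcont hN, hmem] with x hx hxm
  rw [← mem_singleton_iff.1 (hNL ⟨hx, hxm⟩)]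
  ring

/-- In a chart of an elliptic curve, small translations are translations. -/
theorem ellipticChart_add {e : OpenPartialHomeomorph (EllipticCurveOf L) ℂ}
    (he : e ∈ atlas ℂ (EllipticCurveOf L)) {y : EllipticCurveOf L} (hy : y ∈ e.source) :
    ∀ᶠ t : ℂ in 𝓝 0, (t : EllipticCurveOf L) + y ∈ e.source ∧
      e ((t : EllipticCurveOf L) + y) = e y + t := by
  have hcont : ContinuousAt (fun t : ℂ => e y + t) 0 := by fun_prop
  have hmem : ∀ᶠ t : ℂ in 𝓝 0, e y + t ∈ e.target :=
    hcont.eventually (by simpa using e.open_target.mem_nhds (e.map_source hy))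
  filter_upwards [hmem] with t ht
  have h1 := mk_ellipticChart L he ht
  have h2 := mk_ellipticChart L he (e.map_source hy)
  rw [e.left_inv hy] at h2
  have h3 : (t : EllipticCurveOf L) + y = e.symm (e y + t) := by
    rw [h1, add_comm]
    exact congrArg (· + (t : EllipticCurveOf L)) h2
  rw [h3]
  exact ⟨e.map_target ht, e.right_inv ht⟩

end EllipticCurve

/-! ### Holomorphic one-forms on a Riemann surface -/

section OneForms

variable {B : Type*} [TopologicalSpace B] [ChartedSpace ℂ B] [IsManifold 𝓘(ℂ, ℂ) ω B]

/-- The space `H⁰(B, K_B)` of holomorphic one-forms. -/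
abbrev HolomorphicOneForm (B : Type*) [TopologicalSpace B] [ChartedSpace ℂ B]
    [IsManifold 𝓘(ℂ, ℂ) ω B] : Type _ :=
  ContMDiffSection 𝓘(ℂ, ℂ) (ℂ →L[ℂ] ℂ) ω
    (fun x : B => TangentSpace 𝓘(ℂ, ℂ) x →L[ℂ] Bundle.Trivial B ℂ x)

variable {η : OpenPartialHomeomorph B ℂ}

/-- The coefficient of a one-form with respect to the coordinate `η`. -/
noncomputable def formCoeff (α : HolomorphicOneForm B) (η : B → ℂ) (b : B) : ℂ :=
  α b (coordField η 1 b)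

theorem mdifferentiableAt_formCoeff (α : HolomorphicOneForm B)
    (hη : η ∈ IsManifold.maximalAtlas 𝓘(ℂ, ℂ) ω B) {b : B} (hb : b ∈ η.source) :
    MDifferentiableAt 𝓘(ℂ, ℂ) 𝓘(ℂ, ℂ) (formCoeff α η) b := by
  have h := (α.contMDiff b).clm_bundle_apply
    ((contMDiffOn_coordField hη 1).contMDiffAt (η.open_source.mem_nhds hb))
  have h2 := (Bundle.contMDiffAt_section b).1 h
  exact h2.mdifferentiableAt (by simp)

theorem apply_eq_formCoeff_mul (α : HolomorphicOneForm B)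
    (hη : η ∈ IsManifold.maximalAtlas 𝓘(ℂ, ℂ) ω B) {b : B} (hb : b ∈ η.source)
    (v : TangentSpace 𝓘(ℂ, ℂ) b) : α b v = vderiv η b v * formCoeff α η b := by
  have h : v = vderiv η b v • coordField η 1 b := by
    conv_lhs => rw [← coordField_vderiv hη hb v]
    have : vderiv η b v = vderiv η b v • (1 : ℂ) := by simp
    conv_lhs => rw [this, coordField_smul]
    rfl
  conv_lhs => rw [h]
  exact map_smul _ _ _

/-- The identity theorem for holomorphic one-forms. -/
theorem oneForm_eq_zero_of_eventually [ConnectedSpace B] (α : HolomorphicOneForm B) {b₀ : B}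
    (h : ∀ᶠ b in 𝓝 b₀, α b = 0) : α = 0 := by
  let Z : Set B := {b | ∀ᶠ b' in 𝓝 b, α b' = 0}
  have hZo : IsOpen Z := isOpen_iff_mem_nhds.2 fun b hb => hb.eventually_nhds
  have hZc : IsClosed Z := by
    refine isClosed_of_closure_subset fun b hb => ?_
    set η := chartAt ℂ b with hηdef
    have hη : η ∈ IsManifold.maximalAtlas 𝓘(ℂ, ℂ) ω B := IsManifold.chart_mem_maximalAtlas b
    have hbη : b ∈ η.source := mem_chart_source ℂ b
    have han : AnalyticAt ℂ (fun z => formCoeff α η (η.symm z)) (η b) := by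
      rw [Complex.analyticAt_iff_eventually_differentiableAt]
      filter_upwards [η.open_target.mem_nhds (η.map_source hbη)] with z hz
      exact mdifferentiableAt_iff_differentiableAt.1
        ((mdifferentiableAt_formCoeff α hη (η.map_target hz)).comp z
          ((mdifferentiable_chart_of_mem hη).mdifferentiableAt_symm hz))
    have hvan : ∀ b' ∈ η.source, (α b' = 0 ↔ formCoeff α η (η.symm (η b')) = 0) := by
      intro b' hb'
      rw [η.left_inv hb']
      refine ⟨fun h0 => by rw [formCoeff, h0]; rfl, fun h0 => ?_⟩
      refine ContinuousLinearMap.ext fun v => ?_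
      rw [apply_eq_formCoeff_mul α hη hb' v, h0, mul_zero]
      rfl
    -- Zeros of the coefficient are isolated unless it vanishes near `b`. In the isolated case, a
    -- point of `Z` close to `b` can only be `b` itself.
    rcases han.eventually_eq_zero_or_eventually_ne_zero with h0 | h0
    · filter_upwards [(η.continuousAt hbη).eventually h0, η.open_source.mem_nhds hbη] with b' h1 h2
      exact (hvan b' h2).2 h1
    · have h1 : ∀ᶠ b' in 𝓝 b, b' ∈ η.source ∧ (η b' ≠ η b →
          formCoeff α η (η.symm (η b')) ≠ 0) :=
        Filter.Eventually.and (η.open_source.mem_nhds hbη)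
          ((η.continuousAt hbη).eventually (eventually_nhdsWithin_iff.1 h0))
      obtain ⟨b', ⟨hb'1, hb'2⟩, hb'Z⟩ := mem_closure_iff_nhds.1 hb _ h1
      by_cases hbb : η b' = η b
      · rwa [← η.injOn hb'1 hbη hbb]
      · exact absurd ((hvan b' hb'1).1 hb'Z.self_of_nhds) (hb'2 hbb)
  have hZ : Z = univ := IsClopen.eq_univ ⟨hZc, hZo⟩ ⟨b₀, h⟩
  refine ContMDiffSection.ext fun b => ?_
  have hb : b ∈ Z := hZ ▸ mem_univ b
  exact hb.self_of_nhds

/-- A linear functional on the holomorphic one-forms of a Riemann surface of genus at least two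
has a nontrivial kernel. -/
theorem exists_oneForm_mem_ker (hg : 2 ≤ riemannSurfaceGenus B)
    (l : HolomorphicOneForm B →ₗ[ℂ] ℂ) : ∃ α : HolomorphicOneForm B, α ≠ 0 ∧ l α = 0 := by
  have hg' : 2 ≤ Module.finrank ℂ (HolomorphicOneForm B) := hg
  have : FiniteDimensional ℂ (HolomorphicOneForm B) := Module.finite_of_finrank_pos (by omega)
  have hk : LinearMap.ker l ≠ ⊥ := LinearMap.ker_ne_bot_of_finrank_lt (by
    rw [Module.finrank_self]
    omega)
  obtain ⟨α, hα, h0⟩ := Submodule.exists_mem_ne_zero_of_ne_bot hk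
  exact ⟨α, h0, hα⟩

end OneForms

/-! ### Charts of principal elliptic bundles -/

section BundleChart

variable {L : PeriodPair} {B : Type*} [TopologicalSpace B]
  {S : Type*} [TopologicalSpace S] {p : S → B}

/-- The chart of the total space defined by a trivialization, a chart `η` of the base and a chart
`κ` of the fibre. -/
noncomputable def bundleChart (e : Trivialization (EllipticCurveOf L) p)
    (η : OpenPartialHomeomorph B ℂ) (κ : OpenPartialHomeomorph (EllipticCurveOf L) ℂ) :
    OpenPartialHomeomorph S (ℂ × ℂ) :=
  e.toOpenPartialHomeomorph.trans (η.prod κ)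

variable {e : Trivialization (EllipticCurveOf L) p} {η : OpenPartialHomeomorph B ℂ}
  {κ κ' : OpenPartialHomeomorph (EllipticCurveOf L) ℂ}

theorem mem_bundleChart_source {x : S} :
    x ∈ (bundleChart e η κ).source ↔ x ∈ e.source ∧ p x ∈ η.source ∧ (e x).2 ∈ κ.source := by
  constructor
  · intro h
    exact ⟨h.1, e.coe_fst h.1 ▸ h.2.1, h.2.2⟩
  · intro h
    exact ⟨h.1, (e.coe_fst h.1).symm ▸ h.2.1, h.2.2⟩

theorem bundleChart_apply {x : S} (hx : x ∈ e.source) :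
    bundleChart e η κ x = (η (p x), κ (e x).2) := by
  rw [← e.coe_fst hx]
  rfl

variable [ChartedSpace (ℂ × ℂ) S]

/-- Fibre charts differ locally by translations, which have identity differential. -/
theorem vderiv_bundleChart_eventually_eq
    (hm : bundleChart e η κ ∈ IsManifold.maximalAtlas 𝓘(ℂ, ℂ × ℂ) ω S)
    (hκ : κ ∈ atlas ℂ (EllipticCurveOf L)) (hκ' : κ' ∈ atlas ℂ (EllipticCurveOf L)) {x : S}
    (hx : x ∈ (bundleChart e η κ).source) (hx' : x ∈ (bundleChart e η κ').source) :
    ∀ᶠ y in 𝓝 x, vderiv (bundleChart e η κ) y = vderiv (bundleChart e η κ') y := by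
  obtain ⟨k, hk⟩ := ellipticChart_eventually_eq hκ hκ' (mem_bundleChart_source.1 hx).2.2
    (mem_bundleChart_source.1 hx').2.2
  have hc : ContinuousAt (fun y => (e y).2) x :=
    continuousAt_snd.comp (e.toOpenPartialHomeomorph.continuousAt hx.1)
  have hev : ∀ᶠ y in 𝓝 x, bundleChart e η κ' y = bundleChart e η κ y + (0, k) := by
    filter_upwards [hc.eventually hk, e.open_source.mem_nhds hx.1] with y hy hys
    rw [bundleChart_apply hys, bundleChart_apply hys, hy]
    simp
  filter_upwards [hev.eventually_nhds, (bundleChart e η κ).open_source.mem_nhds hx] with y hy hys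
  rw [vderiv_congr hy]
  refine ContinuousLinearMap.ext fun v => ?_
  exact (vderiv_comp ((hasFDerivAt_id _).add_const _)
    ((contMDiffAt_chart hm hys).mdifferentiableAt (by simp)) v).symm

variable [ChartedSpace ℂ B] [IsManifold 𝓘(ℂ, ℂ × ℂ) ω S]

theorem bundleChart_mem_maximalAtlas
    (he : ContMDiffOn 𝓘(ℂ, ℂ × ℂ) (𝓘(ℂ, ℂ).prod 𝓘(ℂ, ℂ)) ω e e.source)
    (he' : ContMDiffOn (𝓘(ℂ, ℂ).prod 𝓘(ℂ, ℂ)) 𝓘(ℂ, ℂ × ℂ) ω e.toOpenPartialHomeomorph.symm e.target)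
    (hη : η ∈ IsManifold.maximalAtlas 𝓘(ℂ, ℂ) ω B)
    (hκ : κ ∈ atlas ℂ (EllipticCurveOf L)) :
    bundleChart e η κ ∈ IsManifold.maximalAtlas 𝓘(ℂ, ℂ × ℂ) ω S := by
  have hκ' : κ ∈ IsManifold.maximalAtlas 𝓘(ℂ, ℂ) ω (EllipticCurveOf L) :=
    IsManifold.subset_maximalAtlas hκ
  rw [IsManifold.mem_maximalAtlas_iff_contMDiffOn]
  constructor
  · intro x hx
    have h1 : ContMDiffAt 𝓘(ℂ, ℂ × ℂ) (𝓘(ℂ, ℂ).prod 𝓘(ℂ, ℂ)) ω e x :=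
      he.contMDiffAt (e.open_source.mem_nhds hx.1)
    have h2 := (contMDiffAt_chart hη hx.2.1).comp x (contMDiffAt_fst.comp x h1)
    have h3 := (contMDiffAt_chart hκ' hx.2.2).comp x (contMDiffAt_snd.comp x h1)
    exact (h2.prodMk_space h3).contMDiffWithinAt
  · intro z hz
    have hz1 : z.1 ∈ η.target := hz.1.1
    have hz2 : z.2 ∈ κ.target := hz.1.2
    have h1 : ContMDiffAt 𝓘(ℂ, ℂ × ℂ) 𝓘(ℂ, ℂ) ω (fun z : ℂ × ℂ => η.symm z.1) z :=
      ((contMDiffOn_symm_of_mem_maximalAtlas hη).contMDiffAt (η.open_target.mem_nhds hz1)).comp z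
        contDiff_fst.contMDiff.contMDiffAt
    have h2 : ContMDiffAt 𝓘(ℂ, ℂ × ℂ) 𝓘(ℂ, ℂ) ω (fun z : ℂ × ℂ => κ.symm z.2) z :=
      ((contMDiffOn_symm_of_mem_maximalAtlas hκ').contMDiffAt (κ.open_target.mem_nhds hz2)).comp z
        contDiff_snd.contMDiff.contMDiffAt
    have h3 := (he'.contMDiffAt (e.open_target.mem_nhds hz.2)).comp z (h1.prodMk h2)
    exact h3.contMDiffWithinAt

variable {D : CovariantDerivative 𝓘(ℂ, ℂ × ℂ) (ℂ × ℂ) (TangentSpace 𝓘(ℂ, ℂ × ℂ) : S → Type _)}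

/-- The Christoffel symbols in the charts of a principal elliptic bundle are constant on the
fibres, because they are holomorphic functions on an elliptic curve. -/
theorem christoffel_bundleChart_eq (hD : IsHolomorphicConnection D)
    (he : ContMDiffOn 𝓘(ℂ, ℂ × ℂ) (𝓘(ℂ, ℂ).prod 𝓘(ℂ, ℂ)) ω e e.source)
    (he' : ContMDiffOn (𝓘(ℂ, ℂ).prod 𝓘(ℂ, ℂ)) 𝓘(ℂ, ℂ × ℂ) ω e.toOpenPartialHomeomorph.symm e.target)
    (hη : η ∈ IsManifold.maximalAtlas 𝓘(ℂ, ℂ) ω B)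
    (hκ : κ ∈ atlas ℂ (EllipticCurveOf L)) {x x' : S} (hx : x ∈ (bundleChart e η κ).source)
    (hx' : x' ∈ (bundleChart e η κ).source) (hxx' : p x = p x') (v y : ℂ × ℂ) :
    christoffel D (bundleChart e η κ) x v y = christoffel D (bundleChart e η κ) x' v y := by
  have hm : ∀ {κ}, κ ∈ atlas ℂ (EllipticCurveOf L) →
      bundleChart e η κ ∈ IsManifold.maximalAtlas 𝓘(ℂ, ℂ × ℂ) ω S := fun hκ =>
    bundleChart_mem_maximalAtlas he he' hη hκ
  have hcongr : ∀ {κ κ'}, κ ∈ atlas ℂ (EllipticCurveOf L) → κ' ∈ atlas ℂ (EllipticCurveOf L) →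
      ∀ {x}, x ∈ (bundleChart e η κ).source → x ∈ (bundleChart e η κ').source →
        christoffel D (bundleChart e η κ) x v y = christoffel D (bundleChart e η κ') x v y :=
    fun hκ hκ' _ hx hx' => christoffel_congr (hm hκ) (hm hκ') hx hx'
      (vderiv_bundleChart_eventually_eq (hm hκ) hκ hκ' hx hx') v y
  set b := p x with hb
  have hbe : b ∈ e.baseSet := e.mem_source.1 hx.1
  have hbη : b ∈ η.source := (mem_bundleChart_source.1 hx).2.1
  let σ : EllipticCurveOf L → S := fun t => e.toOpenPartialHomeomorph.symm (b, t)
  have ht : ∀ t, (b, t) ∈ e.target := fun t => e.mem_target.2 hbe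
  have hσs : ∀ t, σ t ∈ e.source := fun t => e.toOpenPartialHomeomorph.map_target (ht t)
  have hσe : ∀ t, e (σ t) = (b, t) := fun t => e.apply_symm_apply (ht t)
  have hσp : ∀ t, p (σ t) = b := fun t => e.proj_symm_apply (ht t)
  have hσm : ∀ t κ, (σ t ∈ (bundleChart e η κ).source ↔ t ∈ κ.source) := fun t κ => by
    rw [mem_bundleChart_source, hσp, hσe]
    exact ⟨fun h => h.2.2, fun h => ⟨hσs t, hbη, h⟩⟩
  have hσd : ∀ t, MDifferentiableAt 𝓘(ℂ, ℂ) 𝓘(ℂ, ℂ × ℂ) σ t := fun t => by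
    have h1 := he'.contMDiffAt (e.open_target.mem_nhds (ht t))
    exact (h1.comp t ((contMDiffAt_const (c := b)).prodMk contMDiffAt_id)).mdifferentiableAt
      (by simp)
  -- The symbols along the whole fibre over `b`, each taken in the preferred fibre chart at its
  -- point. Changing the fibre chart does not alter them, so `g` is holomorphic on a compact
  -- connected curve, hence constant.
  let g : EllipticCurveOf L → ℂ × ℂ := fun t =>
    christoffel D (bundleChart e η (chartAt ℂ t)) (σ t) v y
  have hg : MDifferentiable 𝓘(ℂ, ℂ) 𝓘(ℂ, ℂ × ℂ) g := by
    intro t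
    have hat := chart_mem_atlas ℂ t
    have h1 := (mdifferentiableAt_christoffel hD (hm hat)
      ((hσm t _).2 (mem_chart_source ℂ t)) v y).comp t (hσd t)
    refine h1.congr_of_eventuallyEq ?_
    filter_upwards [(chartAt ℂ t).open_source.mem_nhds (mem_chart_source ℂ t)] with s hs
    exact hcongr (chart_mem_atlas ℂ s) hat ((hσm s _).2 (mem_chart_source ℂ s)) ((hσm s _).2 hs)
  have hconst := hg.apply_eq_of_compactSpace (e x).2 (e x').2
  have hxσ : ∀ x'' ∈ (bundleChart e η κ).source, p x'' = b →
      christoffel D (bundleChart e η κ) x'' v y = g (e x'').2 := by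
    intro x'' hx'' hpx
    have h2 : σ (e x'').2 = x'' := by
      show e.toOpenPartialHomeomorph.symm (b, (e x'').2) = x''
      rw [← hpx, e.mk_proj_snd hx''.1]
      exact e.toOpenPartialHomeomorph.left_inv hx''.1
    show _ = christoffel D (bundleChart e η _) (σ (e x'').2) v y
    rw [h2]
    refine hcongr hκ (chart_mem_atlas ℂ _) hx'' ?_
    exact mem_bundleChart_source.2 ⟨hx''.1, hpx ▸ hbη, mem_chart_source ℂ _⟩
  rw [hxσ x hx rfl, hxσ x' hx' hxx'.symm, hconst]

end BundleChart

/-! ### Adapted charts of a principal elliptic bundle -/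

section Adapted

variable {L : PeriodPair} {B : Type*} [TopologicalSpace B] [ChartedSpace ℂ B]
  {S : Type*} [TopologicalSpace S] [ChartedSpace (ℂ × ℂ) S] [AddAction (EllipticCurveOf L) S]
  {p : S → B}

/-- The chart `ψ` of `S` has the form `(z, w)`, where `z` is the chart `η` of the base and the
group acts by translation of `w`. -/
structure IsAdaptedChart (L : PeriodPair) [AddAction (EllipticCurveOf L) S] (p : S → B)
    (η : OpenPartialHomeomorph B ℂ) (ψ : OpenPartialHomeomorph S (ℂ × ℂ)) : Prop where
  mem : ψ ∈ IsManifold.maximalAtlas 𝓘(ℂ, ℂ × ℂ) ω S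
  mem_base : η ∈ IsManifold.maximalAtlas 𝓘(ℂ, ℂ) ω B
  proj_mem : ∀ x ∈ ψ.source, p x ∈ η.source
  fst_eq : ∀ x ∈ ψ.source, (ψ x).1 = η (p x)
  vadd_eq : ∀ x ∈ ψ.source, ∀ᶠ t : ℂ in 𝓝 0,
    (t : EllipticCurveOf L) +ᵥ x ∈ ψ.source ∧ ψ ((t : EllipticCurveOf L) +ᵥ x) = ψ x + (0, t)

/-- The vector field that generates the action. -/
noncomputable def verticalField (L : PeriodPair) [AddAction (EllipticCurveOf L) S] (x : S) :
    TangentSpace 𝓘(ℂ, ℂ × ℂ) x :=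
  -- The velocity of the orbit at time 0 lies in the tangent space at 0 + x and must be transported
  -- to `x`.
  have h : (((0 : ℂ) : EllipticCurveOf L) +ᵥ x) = x := zero_vadd _ x
  h ▸ mfderiv 𝓘(ℂ, ℂ) 𝓘(ℂ, ℂ × ℂ) (fun t : ℂ => (t : EllipticCurveOf L) +ᵥ x) 0 (1 : ℂ)

namespace IsPrincipalEllipticBundle

theorem isOpenQuotientMap_proj (hp : IsPrincipalEllipticBundle L p) : IsOpenQuotientMap p where
  surjective b := by
    obtain ⟨e, hb, -⟩ := hp.locally_trivial b
    exact ⟨_, e.proj_symm_apply (x := (b, 0)) (e.mem_target.2 hb)⟩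
  continuous := continuous_iff_continuousAt.2 fun x => by
    obtain ⟨e, hb, -⟩ := hp.locally_trivial (p x)
    exact e.continuousAt_proj (e.mem_source.2 hb)
  isOpenMap := IsOpenMap.of_nhds_le fun x => by
    obtain ⟨e, hb, -⟩ := hp.locally_trivial (p x)
    exact (e.map_proj_nhds (e.mem_source.2 hb)).ge

/-- The base and the fibres are connected, and `p` is a quotient map. -/
theorem preconnectedSpace (hp : IsPrincipalEllipticBundle L p) [ConnectedSpace B] :
    PreconnectedSpace S := by
  have hf : ∀ b, IsConnected (p ⁻¹' {b}) := by
    intro b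
    obtain ⟨e, hb, -⟩ := hp.locally_trivial b
    have ht : ∀ t, (b, t) ∈ e.target := fun t => e.mem_target.2 hb
    have hc : Continuous fun t => e.toOpenPartialHomeomorph.symm (b, t) :=
      e.toOpenPartialHomeomorph.continuousOn_symm.comp_continuous (by fun_prop) ht
    convert! isConnected_range hc
    ext x
    constructor
    · rintro rfl
      refine ⟨(e x).2, ?_⟩
      show e.toOpenPartialHomeomorph.symm (p x, (e x).2) = x
      rw [e.mk_proj_snd (e.mem_source.2 hb)]
      exact e.toOpenPartialHomeomorph.left_inv (e.mem_source.2 hb)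
    · rintro ⟨t, rfl⟩
      exact e.proj_symm_apply (ht t)
  refine ⟨?_⟩
  exact (hp.isOpenQuotientMap_proj.isQuotientMap.isCoinducing.isConnected_preimage_of_isClosed hf
    isClosed_univ isConnected_univ).isPreconnected

variable [IsManifold 𝓘(ℂ, ℂ × ℂ) ω S] [IsManifold 𝓘(ℂ, ℂ) ω B]

theorem exists_isAdaptedChart (hp : IsPrincipalEllipticBundle L p) {D : CovariantDerivative
      𝓘(ℂ, ℂ × ℂ) (ℂ × ℂ) (TangentSpace 𝓘(ℂ, ℂ × ℂ) : S → Type _)}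
    (hD : IsHolomorphicConnection D) (x : S) :
    ∃ η ψ, IsAdaptedChart L p η ψ ∧ x ∈ ψ.source ∧
      ∀ y ∈ ψ.source, ∀ y' ∈ ψ.source, (ψ y).1 = (ψ y').1 → ∀ v w,
        christoffel D ψ y v w = christoffel D ψ y' v w := by
  obtain ⟨e, hb, he, he', hv⟩ := hp.locally_trivial (p x)
  have hη : chartAt ℂ (p x) ∈ IsManifold.maximalAtlas 𝓘(ℂ, ℂ) ω B :=
    IsManifold.chart_mem_maximalAtlas _
  have hκ := chart_mem_atlas ℂ (e x).2
  have hs : ∀ y ∈ (bundleChart e (chartAt ℂ (p x)) (chartAt ℂ (e x).2)).source,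
      (bundleChart e (chartAt ℂ (p x)) (chartAt ℂ (e x).2) y).1 = chartAt ℂ (p x) (p y) :=
    fun y hy => by rw [bundleChart_apply hy.1]
  refine ⟨chartAt ℂ (p x), bundleChart e (chartAt ℂ (p x)) (chartAt ℂ (e x).2),
    ⟨bundleChart_mem_maximalAtlas he he' hη hκ, hη, fun y hy => (mem_bundleChart_source.1 hy).2.1,
      hs, fun y hy => ?_⟩,
    mem_bundleChart_source.2 ⟨e.mem_source.2 hb, mem_chart_source _ _, mem_chart_source _ _⟩,
    fun y hy y' hy' h v w => christoffel_bundleChart_eq hD he he' hη hκ hy hy' ?_ v w⟩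
  · obtain ⟨h1, h2, h3⟩ := mem_bundleChart_source.1 hy
    filter_upwards [ellipticChart_add hκ h3] with t ht
    have h4 : (t : EllipticCurveOf L) +ᵥ y ∈ e.source := by
      rw [e.mem_source, hp.proj_vadd]
      exact e.mem_source.1 h1
    rw [mem_bundleChart_source, bundleChart_apply h4, bundleChart_apply h1, hp.proj_vadd,
      hv y h1]
    exact ⟨⟨h4, h2, ht.1⟩, by rw [ht.2]; simp⟩
  · rw [hs y hy, hs y' hy'] at h
    exact (chartAt ℂ (p x)).injOn (mem_bundleChart_source.1 hy).2.1
      (mem_bundleChart_source.1 hy').2.1 h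

end IsPrincipalEllipticBundle

namespace IsAdaptedChart

variable {η : OpenPartialHomeomorph B ℂ} {ψ : OpenPartialHomeomorph S (ℂ × ℂ)} {x : S}

theorem verticalField_eq (h : IsAdaptedChart L p η ψ) (hx : x ∈ ψ.source) :
    verticalField L x = coordField ψ (0, 1) x := by
  let σ : ℂ → S := fun t => (t : EllipticCurveOf L) +ᵥ x
  have hev : ∀ᶠ t in 𝓝 (0 : ℂ), σ t = ψ.symm (ψ x + (0, t)) := by
    filter_upwards [h.vadd_eq x hx] with t ht
    rw [← ht.2, ψ.left_inv ht.1]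
  have hd : HasFDerivAt (fun t : ℂ => ψ x + (0, t)) (ContinuousLinearMap.inr ℂ ℂ ℂ) 0 :=
    (ContinuousLinearMap.inr ℂ ℂ ℂ).hasFDerivAt.const_add (ψ x)
  have hσ : MDifferentiableAt 𝓘(ℂ, ℂ) 𝓘(ℂ, ℂ × ℂ) σ 0 := by
    have h1 : ψ x + (0, (0 : ℂ)) ∈ ψ.target :=
      (add_zero (ψ x)).symm ▸ ψ.map_source hx
    have h2 := ((mdifferentiable_chart_of_mem h.mem).mdifferentiableAt_symm h1).comp (0 : ℂ)
      hd.differentiableAt.mdifferentiableAt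
    exact h2.congr_of_eventuallyEq hev
  -- With the base point generalized, the transport in `verticalField` disappears on substituting `y
  -- = σ 0`.
  have key : ∀ y (hy : σ 0 = y), y ∈ ψ.source →
      vderiv ψ y (hy ▸ mfderiv 𝓘(ℂ, ℂ) 𝓘(ℂ, ℂ × ℂ) σ 0 (1 : ℂ)) = (0, 1) := by
    rintro y rfl hy
    have h1 : HasMFDerivAt 𝓘(ℂ, ℂ) 𝓘(ℂ, ℂ × ℂ) (fun t => ψ (σ t)) 0
        ((vderiv ψ (σ 0)).comp (mfderiv 𝓘(ℂ, ℂ) 𝓘(ℂ, ℂ × ℂ) σ 0)) :=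
      ((mdifferentiable_chart_of_mem h.mem).mdifferentiableAt hy).hasMFDerivAt.comp 0
        hσ.hasMFDerivAt
    have h2 : (fun t => ψ (σ t)) =ᶠ[𝓝 0] fun t => ψ x + (0, t) := by
      filter_upwards [h.vadd_eq x hx] with t ht
      exact ht.2
    have h3 := hasMFDerivAt_unique h1 (hd.hasMFDerivAt.congr_of_eventuallyEq h2)
    exact congrArg (fun T : ℂ →L[ℂ] ℂ × ℂ => T 1) h3
  rw [← coordField_vderiv h.mem hx (verticalField L x)]
  exact congrArg (fun u => coordField ψ u x) (key x (zero_vadd _ x) hx)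

theorem vderiv_verticalField (h : IsAdaptedChart L p η ψ) (hx : x ∈ ψ.source) :
    vderiv ψ x (verticalField L x) = (0, 1) := by
  rw [h.verticalField_eq hx, vderiv_coordField h.mem hx]

theorem mdifferentiableAt_proj (h : IsAdaptedChart L p η ψ) (hx : x ∈ ψ.source) :
    MDifferentiableAt 𝓘(ℂ, ℂ × ℂ) 𝓘(ℂ, ℂ) p x := by
  have h1 : MDifferentiableAt 𝓘(ℂ, ℂ × ℂ) 𝓘(ℂ, ℂ) (fun y => (ψ y).1) x :=
    differentiableAt_fst.mdifferentiableAt.comp x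
      ((mdifferentiable_chart_of_mem h.mem).mdifferentiableAt hx)
  have h2 : MDifferentiableAt 𝓘(ℂ, ℂ) 𝓘(ℂ, ℂ) η.symm (ψ x).1 := by
    rw [h.fst_eq x hx]
    exact (mdifferentiable_chart_of_mem h.mem_base).mdifferentiableAt_symm
      (η.map_source (h.proj_mem x hx))
  refine (h2.comp x h1).congr_of_eventuallyEq ?_
  filter_upwards [ψ.open_source.mem_nhds hx] with y hy
  show p y = η.symm (ψ y).1
  rw [h.fst_eq y hy, η.left_inv (h.proj_mem y hy)]

theorem vderiv_mfderiv_proj (h : IsAdaptedChart L p η ψ) (hx : x ∈ ψ.source)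
    (v : TangentSpace 𝓘(ℂ, ℂ × ℂ) x) :
    vderiv η (p x) (mfderiv 𝓘(ℂ, ℂ × ℂ) 𝓘(ℂ, ℂ) p x v) = (vderiv ψ x v).1 := by
  have h1 : HasMFDerivAt 𝓘(ℂ, ℂ × ℂ) 𝓘(ℂ, ℂ) (fun y => η (p y)) x
      ((vderiv η (p x)).comp (mfderiv 𝓘(ℂ, ℂ × ℂ) 𝓘(ℂ, ℂ) p x)) :=
    ((mdifferentiable_chart_of_mem h.mem_base).mdifferentiableAt
      (h.proj_mem x hx)).hasMFDerivAt.comp x (h.mdifferentiableAt_proj hx).hasMFDerivAt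
  have h2 : HasMFDerivAt 𝓘(ℂ, ℂ × ℂ) 𝓘(ℂ, ℂ) (fun y => (ψ y).1) x
      ((ContinuousLinearMap.fst ℂ ℂ ℂ).comp (vderiv ψ x)) :=
    hasFDerivAt_fst.hasMFDerivAt.comp x
      ((mdifferentiable_chart_of_mem h.mem).mdifferentiableAt hx).hasMFDerivAt
  have h3 : (fun y => η (p y)) =ᶠ[𝓝 x] fun y => (ψ y).1 := by
    filter_upwards [ψ.open_source.mem_nhds hx] with y hy
    exact (h.fst_eq y hy).symm
  have h4 := hasMFDerivAt_unique h1 (h2.congr_of_eventuallyEq h3)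
  exact congrArg (fun T : TangentSpace 𝓘(ℂ, ℂ × ℂ) x →L[ℂ] ℂ => T v) h4

variable [IsManifold 𝓘(ℂ, ℂ × ℂ) ω S] {D : CovariantDerivative
      𝓘(ℂ, ℂ × ℂ) (ℂ × ℂ) (TangentSpace 𝓘(ℂ, ℂ × ℂ) : S → Type _)}

theorem vderiv_connection_verticalField (h : IsAdaptedChart L p η ψ) (hx : x ∈ ψ.source)
    (v : TangentSpace 𝓘(ℂ, ℂ × ℂ) x) :
    vderiv ψ x (D (verticalField L) x v) = christoffel D ψ x (vderiv ψ x v) (0, 1) := by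
  have hev : ∀ᶠ y in 𝓝 x, verticalField L y = coordField ψ (0, 1) y := by
    filter_upwards [ψ.open_source.mem_nhds hx] with y hy
    exact h.verticalField_eq hy
  have h1 := mdifferentiableAt_coordField h.mem hx (0, 1)
  have h2 : MDifferentiableAt 𝓘(ℂ, ℂ × ℂ) (𝓘(ℂ, ℂ × ℂ).prod 𝓘(ℂ, ℂ × ℂ))
      (fun y => (⟨y, verticalField L y⟩ :
        TotalSpace (ℂ × ℂ) (TangentSpace 𝓘(ℂ, ℂ × ℂ) : S → Type _))) x := by
    refine h1.congr_of_eventuallyEq ?_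
    filter_upwards [hev] with y hy
    rw [hy]
  rw [christoffel, coordField_vderiv h.mem hx,
    D.isCovariantDerivativeOnUniv.congr_of_eventuallyEq h2 h1 Filter.univ_mem hev]

/-- The trace of the endomorphism `∇X` in an adapted chart, `X` being the vertical field. -/
theorem trace_connection_verticalField (h : IsAdaptedChart L p η ψ) (hx : x ∈ ψ.source) :
    LinearMap.trace ℂ (TangentSpace 𝓘(ℂ, ℂ × ℂ) x) (D (verticalField L) x).toLinearMap =
      (christoffel D ψ x (1, 0) (0, 1)).1 + (christoffel D ψ x (0, 1) (0, 1)).2 := by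
  obtain ⟨E, hE⟩ := isInvertible_vderiv h.mem hx
  have hE' : ∀ v, E v = vderiv ψ x v := fun v => by rw [← hE]; rfl
  -- The trace is invariant under conjugation by the differential of the chart, after which it is
  -- read off in the standard basis.
  rw [← LinearMap.trace_conj' _ E.toLinearEquiv,
    LinearMap.trace_eq_matrix_trace ℂ (Module.Basis.finTwoProd ℂ), Matrix.trace_fin_two]
  have key : ∀ w, E (D (verticalField L) x (E.symm w)) = christoffel D ψ x w (0, 1) := fun w => by
    rw [hE', h.vderiv_connection_verticalField hx, ← hE', E.apply_symm_apply]
  simp [LinearMap.toMatrix_apply, LinearEquiv.conj_apply, key]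

end IsAdaptedChart

end Adapted

/-! ### Connections on principal elliptic bundles -/

section PrincipalBundle

variable {L : PeriodPair}
  {B : Type*} [TopologicalSpace B]
  [ChartedSpace ℂ B] [IsManifold 𝓘(ℂ, ℂ) ω B]
  {S : Type*} [TopologicalSpace S]
  [ChartedSpace (ℂ × ℂ) S] [IsManifold 𝓘(ℂ, ℂ × ℂ) ω S]
  [AddAction (EllipticCurveOf L) S] {p : S → B}
  {D : CovariantDerivative 𝓘(ℂ, ℂ × ℂ) (ℂ × ℂ) (TangentSpace 𝓘(ℂ, ℂ × ℂ) : S → Type _)}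
  {η : OpenPartialHomeomorph B ℂ} {ψ : OpenPartialHomeomorph S (ℂ × ℂ)} {x : S}

/-- The contraction of the pull-back of the one-form `α` with the covariant derivative of the
vertical field along itself. -/
noncomputable def formVertical (D : CovariantDerivative 𝓘(ℂ, ℂ × ℂ) (ℂ × ℂ)
      (TangentSpace 𝓘(ℂ, ℂ × ℂ) : S → Type _)) (L : PeriodPair) [AddAction (EllipticCurveOf L) S]
    (p : S → B) (x : S) : HolomorphicOneForm B →ₗ[ℂ] ℂ where
  toFun α := α (p x) (mfderiv 𝓘(ℂ, ℂ × ℂ) 𝓘(ℂ, ℂ) p x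
    (D (verticalField L) x (verticalField L x)))
  map_add' _ _ := rfl
  map_smul' _ _ := rfl

theorem IsAdaptedChart.formVertical_eq (h : IsAdaptedChart L p η ψ) (hx : x ∈ ψ.source)
    (α : HolomorphicOneForm B) : formVertical D L p x α =
      (christoffel D ψ x (0, 1) (0, 1)).1 * formCoeff α η (p x) := by
  refine (apply_eq_formCoeff_mul α h.mem_base (h.proj_mem x hx) _).trans ?_
  rw [h.vderiv_mfderiv_proj hx, h.vderiv_connection_verticalField hx, h.vderiv_verticalField hx]

namespace IsPrincipalEllipticBundle

variable [ConnectedSpace B] [CompactSpace S]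

/-- The maximum principle on the compact connected surface, in the form used three times below:
holomorphy need only be checked on a formula valid in each adapted chart. -/
theorem eq_of_isAdaptedChart (hp : IsPrincipalEllipticBundle L p) (hD : IsHolomorphicConnection D)
    {f : S → ℂ} (hf : ∀ η ψ, IsAdaptedChart L p η ψ → ∃ g : S → ℂ, ∀ x ∈ ψ.source,
      f x = g x ∧ MDifferentiableAt 𝓘(ℂ, ℂ × ℂ) 𝓘(ℂ, ℂ) g x) (x y : S) : f x = f y := by
  have := hp.preconnectedSpace
  have hd : MDifferentiable 𝓘(ℂ, ℂ × ℂ) 𝓘(ℂ, ℂ) f := by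
    intro x
    obtain ⟨η, ψ, h, hx, -⟩ := hp.exists_isAdaptedChart hD x
    obtain ⟨g, hg⟩ := hf η ψ h
    refine (hg x hx).2.congr_of_eventuallyEq ?_
    filter_upwards [ψ.open_source.mem_nhds hx] with y hy
    exact (hg y hy).1
  exact hd.apply_eq_of_compactSpace x y

/-- The covariant derivative of the vertical field along itself is vertical. -/
theorem christoffel_vertical_fst (hp : IsPrincipalEllipticBundle L p)
    (hg : 2 ≤ riemannSurfaceGenus B) (hD : IsHolomorphicConnection D)
    (h : IsAdaptedChart L p η ψ) (hx : x ∈ ψ.source) :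
    (christoffel D ψ x (0, 1) (0, 1)).1 = 0 := by
  obtain ⟨α, hα, hlα⟩ := exists_oneForm_mem_ker hg (formVertical D L p x)
  -- The contraction with `α` is constant on `S`, and `α` was chosen to make it vanish at `x`.
  have hconst : ∀ y, formVertical D L p y α = 0 := fun y => by
    rw [← hlα]
    refine hp.eq_of_isAdaptedChart (f := fun y => formVertical D L p y α) hD
      (fun η ψ h => ⟨_, fun x hx => ⟨h.formVertical_eq hx α, ?_⟩⟩) y x
    exact (differentiableAt_fst.mdifferentiableAt.comp x
      (mdifferentiableAt_christoffel hD h.mem hx (0, 1) (0, 1))).mul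
      ((mdifferentiableAt_formCoeff α h.mem_base (h.proj_mem x hx)).comp x
        (h.mdifferentiableAt_proj hx))
  by_contra hne
  have hc : ContinuousAt (fun y => (christoffel D ψ y (0, 1) (0, 1)).1) x :=
    (mdifferentiableAt_christoffel hD h.mem hx (0, 1) (0, 1)).continuousAt.fst
  -- If the component were nonzero at `x`, then `α` would vanish on the image of a neighbourhood,
  -- which is open, hence identically.
  have hev : ∀ᶠ y in 𝓝 x, α (p y) = 0 := by
    filter_upwards [hc.eventually_ne hne, ψ.open_source.mem_nhds hx] with y hy hys
    have h0 := hconst y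
    rw [h.formVertical_eq hys] at h0
    refine ContinuousLinearMap.ext fun v => ?_
    rw [apply_eq_formCoeff_mul α h.mem_base (h.proj_mem y hys) v,
      (mul_eq_zero.1 h0).resolve_left hy, mul_zero]
    rfl
  exact hα (oneForm_eq_zero_of_eventually α
    (hp.isOpenQuotientMap_proj.isOpenMap.nhds_le x hev))

/-- The covariant derivative of the vertical field along itself is a constant multiple of the
vertical field. -/
theorem exists_christoffel_vertical (hp : IsPrincipalEllipticBundle L p)
    (hg : 2 ≤ riemannSurfaceGenus B) (hD : IsHolomorphicConnection D) :
    ∃ c : ℂ, ∀ η ψ, IsAdaptedChart L p η ψ → ∀ x ∈ ψ.source,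
      christoffel D ψ x (0, 1) (0, 1) = (0, c) := by
  choose η₀ ψ₀ h₀ hx₀ _ using fun x => hp.exists_isAdaptedChart hD x
  -- Since ∇_X X is a multiple of X, its second component is that multiple in every adapted chart;
  -- any choice of charts defines the same function.
  let f : S → ℂ := fun x =>
    (vderiv (ψ₀ x) x (D (verticalField L) x (verticalField L x))).2
  have hf : ∀ η ψ, IsAdaptedChart L p η ψ → ∀ x ∈ ψ.source,
      f x = (christoffel D ψ x (0, 1) (0, 1)).2 := by
    intro η ψ h x hx
    set c := (christoffel D ψ x (0, 1) (0, 1)).2 with hc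
    have h1 : vderiv ψ x (D (verticalField L) x (verticalField L x)) = c • (0, 1) := by
      rw [h.vderiv_connection_verticalField hx, h.vderiv_verticalField hx]
      ext
      · simp [hp.christoffel_vertical_fst hg hD h hx]
      · simp [hc]
    have h2 : D (verticalField L) x (verticalField L x) = c • verticalField L x := by
      rw [← coordField_vderiv h.mem hx (D (verticalField L) x (verticalField L x)), h1,
        coordField_smul, Pi.smul_apply, h.verticalField_eq hx]
    show (vderiv (ψ₀ x) x _).2 = c
    rw [h2, map_smul, (h₀ x).vderiv_verticalField (hx₀ x)]
    simp
  rcases isEmpty_or_nonempty S with hS | ⟨⟨x₀⟩⟩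
  · exact ⟨0, fun _ _ _ x => hS.elim x⟩
  refine ⟨f x₀, fun η ψ h x hx => Prod.ext (hp.christoffel_vertical_fst hg hD h hx) ?_⟩
  rw [← hf η ψ h x hx]
  exact hp.eq_of_isAdaptedChart hD (fun η ψ h => ⟨_, fun x hx => ⟨hf η ψ h x hx,
    differentiableAt_snd.mdifferentiableAt.comp x
      (mdifferentiableAt_christoffel hD h.mem hx (0, 1) (0, 1))⟩⟩) x x₀

/-- The trace of ∇X is defined without coordinates and equals c + d in every adapted chart, so d is
a global holomorphic function on a compact connected surface. -/
theorem exists_christoffel_mixed (hp : IsPrincipalEllipticBundle L p)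
    (hg : 2 ≤ riemannSurfaceGenus B) (hD : IsHolomorphicConnection D) :
    ∃ d : ℂ, ∀ η ψ, IsAdaptedChart L p η ψ → ∀ x ∈ ψ.source,
      (christoffel D ψ x (1, 0) (0, 1)).1 = d := by
  obtain ⟨c, hc⟩ := hp.exists_christoffel_vertical hg hD
  let f : S → ℂ := fun x =>
    LinearMap.trace ℂ (TangentSpace 𝓘(ℂ, ℂ × ℂ) x) (D (verticalField L) x).toLinearMap - c
  have hf : ∀ η ψ, IsAdaptedChart L p η ψ → ∀ x ∈ ψ.source,
      f x = (christoffel D ψ x (1, 0) (0, 1)).1 := fun η ψ h x hx => by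
    simp only [f, h.trace_connection_verticalField hx, hc η ψ h x hx, add_sub_cancel_right]
  rcases isEmpty_or_nonempty S with hS | ⟨⟨x₀⟩⟩
  · exact ⟨0, fun _ _ _ x => hS.elim x⟩
  refine ⟨f x₀, fun η ψ h x hx => ?_⟩
  rw [← hf η ψ h x hx]
  exact hp.eq_of_isAdaptedChart hD (fun η ψ h => ⟨_, fun x hx => ⟨hf η ψ h x hx,
    differentiableAt_fst.mdifferentiableAt.comp x
      (mdifferentiableAt_christoffel hD h.mem hx (1, 0) (0, 1))⟩⟩) x x₀

/-- A torsion-free holomorphic affine connection on a principal elliptic bundle over a Riemann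
surface of genus at least two is projectively flat. -/
theorem isProjectivelyFlat (hp : IsPrincipalEllipticBundle L p) (hg : 2 ≤ riemannSurfaceGenus B)
    (hD : IsHolomorphicConnection D) (hT : D.torsion = 0) : IsProjectivelyFlat D := by
  obtain ⟨c, hc⟩ := hp.exists_christoffel_vertical hg hD
  obtain ⟨d, hd⟩ := hp.exists_christoffel_mixed hg hD
  intro x
  obtain ⟨η, ψ, h, hx, hz⟩ := hp.exists_isAdaptedChart hD x
  exact exists_flat_chart hD hT h.mem hx (hc η ψ h) (hd η ψ h) hz

end IsPrincipalEllipticBundle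

end PrincipalBundle

theorem mainTheorem6 :
    (∀ (L : PeriodPair)
      (B : Type u) [TopologicalSpace B] [T2Space B] [CompactSpace B] [ConnectedSpace B]
      [ChartedSpace ℂ B] [IsManifold 𝓘(ℂ, ℂ) ω B]
      (S : Type v) [TopologicalSpace S] [T2Space S] [CompactSpace S]
      [ChartedSpace (ℂ × ℂ) S] [IsManifold 𝓘(ℂ, ℂ × ℂ) ω S]
      [AddAction (EllipticCurveOf L) S] (p : S → B),
      IsPrincipalEllipticBundle L p →
      2 ≤ riemannSurfaceGenus B →
      Odd (firstBettiNumber S) →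
      ∀ D : CovariantDerivative 𝓘(ℂ, ℂ × ℂ) (ℂ × ℂ)
          (TangentSpace 𝓘(ℂ, ℂ × ℂ) : S → Type _),
        IsHolomorphicConnection D → D.torsion = 0 → IsProjectivelyFlat D) ∧
    (∀ D : CovariantDerivative 𝓘(ℂ, ℂ × ℂ) (ℂ × ℂ)
        (TangentSpace 𝓘(ℂ, ℂ × ℂ) : ℂ × ℂ → Type _),
      IsHolomorphicConnection D → D.torsion = 0 → IsTranslationInvariant D →
        IsProjectivelyFlat D) :=
  ⟨fun _ _ _ _ _ _ _ _ _ _ _ _ _ _ _ _ hp hg _ _ hD hT => hp.isProjectivelyFlat hg hD hT,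
    fun _ hD hT hI => isProjectivelyFlat_of_isTranslationInvariant hD hT hI⟩
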